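/- Let $\mathcal X\subset\mathbb R^{d}$ be compact, let $k:\mathcal X\times\mathcal X\to\mathbb R$ be a (measurable) positive semidefinite kernel with $k(x,x)\le 1$ for all $x\in\mathcal X$, and let $\mathcal H_k$ be its reproducing kernel Hilbert space, with feature map $\phi(x)=k(x,\cdot)$. Let $s(a)=(1+e^{-a})^{-1}$ and $\dot s=s(1-s)$. Let $f\in\mathcal H_k$ with $\|f\|_k\le B$, let $x^\star$ maximize $f$ over $\mathcal X$, and let $\lambda>0$, $\delta\in(0,1]$. Put $\kappa=\sup_{|a|\le B}1/\dot s(a)$, $L=\sup_{|a|\le B}\dot s(a)$. For points $x_1,\dots,x_t\in\mathcal X$ let $K_t=(k(x_i,x_j))_{i,j\le t}$, $k_t(x)=(k(x_1,x),\dots,k(x_t,x))^\top$, and $$\sigma_t^2(x)=k(x,x)-k_t(x)^\top(K_t+\lambda\kappa I_t)^{-1}k_t(x),\qquad \gamma_t=\sup_{x_1,\dots,x_t\in\mathcal X}\tfrac12\log\det\bigl(I_t+(\lambda\kappa)^{-1}K_t\bigr),$$ $$\beta_t(\delta)=4LB+2L\sqrt{\tfrac{2\kappa}{\lambda}\bigl(\gamma_t+\log(1/\delta)\bigr)}\qquad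 (t\ge 0).$$ *Environment.* In round $t\ge 1$ an action $x_t\in\mathcal X$ is chosen on the basis of the past, and a feedback $y_t\in\{0,1\}$ is observed which, conditionally on the past including $x_t$, equals $1$ with probability $s(f(x_t))$. *Estimator.* Given $x_1,y_1,\dots,x_t,y_t$, let $f_t^0\in\mathcal H_k$ be the minimizer of $$h\mapsto\sum_{\tau=1}^t\Bigl(-y_\tau\log s(h(x_\tau))-(1-y_\tau)\log\bigl(1-s(h(x_\tau))\bigr)\Bigr)+\tfrac\lambda2\|h\|_k^2 ,$$ and let $f_t$ be any minimizer, over the ball $\{h:\|h\|_k\le B\}$, of $h\mapsto\|g_t(h)-g_t(f_t^0)\|_{V_t^{-1}}$, where $g_t(h)=\sum_{\tau\le t}s(h(x_\tau))\phi(x_\tau)+\lambda h$, $V_t=\sum_{\tau\le t}\phi(x_\tau)\otimes\phi(x_\tau)+\kappa\lambda I$ and $\|u\|_{V_t^{-1}}^2=\langle u,V_t^{-1}u\rangle_k$. (In particular $f_t=f_t^0$ is admissible whenever $\|f_t^0\|_k\le B$.) *LGP-UCB.* In every round $t\ge1$ the algorithm plays $$x_t\in\operatorname*{arg\,max}_{x\in\mathcal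 X}\; s(f_{t-1}(x))+\beta_{t-1}(\delta)\,\sigma_{t-1}(x).$$ Then the logistic regret $R^{\mathrm L}(T)=\sum_{t=1}^T\bigl(s(f(x^\star))-s(f(x_t))\bigr)$ of LGP-UCB satisfies $$\mathbb P\Bigl(\forall T\ge 0:\ R^{\mathrm L}(T)\le C_L\,\beta_T(\delta)\sqrt{T\gamma_T}\Bigr)\ge 1-\delta,\qquad C_L=\sqrt{8/\log\bigl(1+(\lambda\kappa)^{-1}\bigr)} .$$ -/

import Mathlib

open MeasureTheory ProbabilityTheory Set

noncomputable section

namespace LogisticBandit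

/-- Derivative of the sigmoid, `s' = s (1 - s)`. -/
def sigmoidDeriv (a : ℝ) : ℝ := Real.sigmoid a * (1 - Real.sigmoid a)

/-- `κ = sup_{|a| ≤ B} 1 / s'(a)`. -/
def kappa (B : ℝ) : ℝ := ⨆ a : Icc (-B) B, 1 / sigmoidDeriv a

/-- `L = sup_{|a| ≤ B} s'(a)`. -/
def lipConst (B : ℝ) : ℝ := ⨆ a : Icc (-B) B, sigmoidDeriv a

section Kernel

variable {X : Type*} (H : Type*) [NormedAddCommGroup H] [InnerProductSpace ℝ H]
  [CompleteSpace H] [RKHS ℝ H X ℝ]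

/-- The feature map `φ(x) = k(x, ·)`, as an element of the RKHS. -/
def feature (x : X) : H := RKHS.kerFun H x 1

/-- The real-valued reproducing kernel `k(x, y)` of the RKHS. -/
def ker (x y : X) : ℝ := RKHS.kernel H x y 1

/-- The kernel matrix `K_t` of a finite sequence of points. -/
def kernelMatrix {t : ℕ} (x : Fin t → X) : Matrix (Fin t) (Fin t) ℝ :=
  Matrix.of fun i j => ker H (x i) (x j)

/-- The vector `k_t(z) = (k(x_1, z), …, k(x_t, z))`. -/
def kernelVec {t : ℕ} (x : Fin t → X) (z : X) : Fin t → ℝ := fun i => ker H (x i) z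

/-- `σ_t(z)`, with
`σ_t²(z) = k(z, z) - k_t(z)ᵀ (K_t + λκ I)⁻¹ k_t(z)`. -/
def sigmaT (lam B : ℝ) {t : ℕ} (x : Fin t → X) (z : X) : ℝ :=
  Real.sqrt (ker H z z - dotProduct (kernelVec H x z)
    (Matrix.mulVec (kernelMatrix H x + (lam * kappa B) • (1 : Matrix (Fin t) (Fin t) ℝ))⁻¹
      (kernelVec H x z)))

/-- Maximal information gain
`γ_t = sup_{x_1, …, x_t} (1/2) log det (I_t + (λκ)⁻¹ K_t)`. -/
def gammaT (X : Type*) (H : Type*) [NormedAddCommGroup H] [InnerProductSpace ℝ H]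
    [CompleteSpace H] [RKHS ℝ H X ℝ] (lam B : ℝ) (t : ℕ) : ℝ :=
  ⨆ x : Fin t → X, 1 / 2 * Real.log
    (1 + (lam * kappa B)⁻¹ • kernelMatrix H x : Matrix (Fin t) (Fin t) ℝ).det

/-- `β_t(δ) = 4LB + 2L √((2κ/λ) (γ_t + log (1/δ)))`. -/
def betaT (X : Type*) (H : Type*) [NormedAddCommGroup H] [InnerProductSpace ℝ H]
    [CompleteSpace H] [RKHS ℝ H X ℝ] (lam B δ : ℝ) (t : ℕ) : ℝ :=
  4 * lipConst B * B + 2 * lipConst B *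
    Real.sqrt (2 * kappa B / lam * (gammaT X H lam B t + Real.log (1 / δ)))

variable {H}

/-- The regularized logistic negative log-likelihood of `f` given the history
`(x_1, y_1), …, (x_t, y_t)`. -/
def logisticLoss (lam : ℝ) {t : ℕ} (x : Fin t → X) (y : Fin t → ℝ) (f : H) : ℝ :=
  (∑ i, (-y i * Real.log (Real.sigmoid (f (x i)))
    - (1 - y i) * Real.log (1 - Real.sigmoid (f (x i))))) + lam / 2 * ‖f‖ ^ 2

/-- `g_t(f) = ∑_τ s(f(x_τ)) φ(x_τ) + λ f`. -/
def gradMap (lam : ℝ) {t : ℕ} (x : Fin t → X) (f : H) : H :=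
  (∑ i, Real.sigmoid (f (x i)) • feature H (x i)) + lam • f

variable (H) in
/-- `V_t = ∑_τ φ(x_τ) ⊗ φ(x_τ) + κλ I`, as a bounded operator on the RKHS. -/
def covOp (lam B : ℝ) {t : ℕ} (x : Fin t → X) : H →L[ℝ] H :=
  (∑ i, InnerProductSpace.rankOne ℝ (feature H (x i)) (feature H (x i)))
    + (kappa B * lam) • ContinuousLinearMap.id ℝ H

/-- `‖u‖_{V_t⁻¹} = √⟨u, V_t⁻¹ u⟩`. -/
def invCovNorm (lam B : ℝ) {t : ℕ} (x : Fin t → X) (u : H) : ℝ :=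
  Real.sqrt (inner ℝ u ((covOp H lam B x).inverse u))

/-- `f` is the kernelized logistic estimate, projected to the ball of radius `B`: with `f₀` a
(global) minimizer of the regularized loss over the RKHS, `f` minimizes
`h ↦ ‖g_t(h) - g_t(f₀)‖_{V_t⁻¹}` over the ball `‖h‖ ≤ B`. -/
def IsEstimate (lam B : ℝ) {t : ℕ} (x : Fin t → X) (y : Fin t → ℝ) (f : H) : Prop :=
  ∃ f₀ : H, IsMinOn (logisticLoss lam x y) univ f₀ ∧ ‖f‖ ≤ B ∧
    ∀ h : H, ‖h‖ ≤ B → invCovNorm lam B x (gradMap lam x f - gradMap lam x f₀)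
      ≤ invCovNorm lam B x (gradMap lam x h - gradMap lam x f₀)

/-- If the unprojected minimizer of the loss already lies in the ball of radius `B`, then it is
an estimate in the above sense (no projection takes place). -/
theorem IsEstimate.of_isMinOn {lam B : ℝ} {t : ℕ} {x : Fin t → X} {y : Fin t → ℝ} {f : H}
    (hf : IsMinOn (logisticLoss lam x y) univ f) (hB : ‖f‖ ≤ B) : IsEstimate lam B x y f := by
  refine ⟨f, hf, hB, fun h _ => ?_⟩
  have h0 : invCovNorm lam B x (gradMap lam x f - gradMap lam x f) = 0 := by
    simp [invCovNorm]
  rw [h0]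
  exact Real.sqrt_nonneg _

variable {Ω : Type*} {m : MeasurableSpace Ω}

/-- The bandit environment with direct logistic feedback and utility `f`. Rounds are numbered from
`0`: `x t`, `y t` are the action and the feedback of the `(t+1)`-st round, and `ℱ t` is the
information available when the action `x t` has been chosen and `y t` not yet been observed. The
feedback is binary, with conditional probability `s(f(x t))` of being `1`. -/
structure IsLogisticFeedback [MeasurableSpace X] (P : Measure Ω) (ℱ : Filtration ℕ m) (f : H)
    (x : ℕ → Ω → X) (y : ℕ → Ω → ℝ) : Prop where
  measurable_action : ∀ t, Measurable[ℱ t] (x t)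
  measurable_feedback : ∀ t, Measurable[ℱ (t + 1)] (y t)
  binary : ∀ t ω, y t ω = 0 ∨ y t ω = 1
  prob_one : ∀ t, P⟦{ω | y t ω = 1} | ℱ t⟧ =ᵐ[P] fun ω => Real.sigmoid (f (x t ω))

/-- The actions `x` are chosen by LGP-UCB: after `t` rounds the next action maximizes
`z ↦ s(f_t(z)) + β_t(δ) σ_t(z)`, where the estimate `f_t` and the width `σ_t` are computed from the
first `t` actions and feedbacks. -/
structure IsLGPUCB (lam B δ : ℝ) (x : ℕ → Ω → X) (y : ℕ → Ω → ℝ) (fhat : ℕ → Ω → H) : Prop where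
  estimate : ∀ (t : ℕ) (ω : Ω),
    IsEstimate lam B (fun i : Fin t => x i ω) (fun i : Fin t => y i ω) (fhat t ω)
  optimistic : ∀ (t : ℕ) (ω : Ω),
    IsMaxOn (fun z : X => Real.sigmoid (fhat t ω z)
      + betaT X H lam B δ t * sigmaT H lam B (fun i : Fin t => x i ω) z) univ (x t ω)

/-- Logistic regret `R(T) = ∑_{t=1}^T (s(f(x⋆)) - s(f(x_t)))` of the first `T` actions. -/
def logisticRegret (f : H) (xstar : X) (x : ℕ → X) (T : ℕ) : ℝ :=
  ∑ t ∈ Finset.range T, (Real.sigmoid (f xstar) - Real.sigmoid (f (x t)))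

end Kernel

/-- `C_L = √(8 / log (1 + (λκ)⁻¹))`. -/
def regretConst (lam B : ℝ) : ℝ := Real.sqrt (8 / Real.log (1 + (lam * kappa B)⁻¹))

end LogisticBandit

end

/-! Write `V_t` for the regularized covariance with `c = λκ`, and `S_t` for the noise sum `∑ (y_i -
s(f(x_i))) φ(x_i)`. The argument has a probabilistic half and a pathwise half.

Noise: `exp(½‖S_t‖²_{V_t⁻¹}) / √det(I + c⁻¹K_t)` is a nonnegative supermartingale started at 1
(`supermartingale_expProc`). Adding one vector changes the form by Sherman–Morrison and the
determinant by a Schur complement, so each step reduces to a one-dimensional Gaussian mixture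
(`bernoulli_mixture_le`), and no Gaussian measure on the RKHS is needed. Ville's inequality gives
`‖S_t‖²_{V_t⁻¹} ≤ 2(γ_t + log(1/δ))` for all `t` at once, with probability at least `1 - δ`.

Pathwise: stationarity of the loss gives `g_t(f) - g_t(f_t⁰) = λf - S_t`. On the ball `g_t` is
strongly monotone because `s' ≥ 1/κ`, so closeness of images under `g_t` becomes closeness of
function values, with width proportional to `σ_t` (`abs_apply_sub_le`,
`abs_sigmoid_estimate_sub_le`). Optimism bounds the regret of each round by `2βσ`; Cauchy–Schwarz
and the elliptical potential bound `sum_sigmaT_sq_le` sum these up. -/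

noncomputable section

namespace LogisticBandit

/-! ### Inverse, dual norm and determinant under rank-one updates. -/

section RegularizedOperator

variable {E : Type*} [NormedAddCommGroup E] [InnerProductSpace ℝ E]

/-- The regularized covariance operator `∑ uᵢ ⊗ uᵢ + c I`. -/
def regOp (c : ℝ) {t : ℕ} (u : Fin t → E) : E →L[ℝ] E :=
  (∑ i, InnerProductSpace.rankOne ℝ (u i) (u i)) + c • ContinuousLinearMap.id ℝ E

lemma regOp_apply (c : ℝ) {t : ℕ} (u : Fin t → E) (p : E) :
    regOp c u p = (∑ i, inner ℝ (u i) p • u i) + c • p := by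
  simp [regOp]

lemma regOp_succ (c : ℝ) {t : ℕ} (u : Fin (t + 1) → E) (p : E) :
    regOp c u p = regOp c (fun i : Fin t => u i.castSucc) p
      + inner ℝ (u (Fin.last t)) p • u (Fin.last t) := by
  simp only [regOp_apply, Fin.sum_univ_castSucc]
  abel

lemma inner_regOp (c : ℝ) {t : ℕ} (u : Fin t → E) (p q : E) :
    inner ℝ p (regOp c u q) = (∑ i, inner ℝ (u i) p * inner ℝ (u i) q) + c * inner ℝ p q := by
  simp only [regOp_apply, inner_add_right, inner_sum, inner_smul_right]
  congr 1
  exact Finset.sum_congr rfl fun i _ => by rw [real_inner_comm p (u i)]; ring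

lemma inner_regOp_comm (c : ℝ) {t : ℕ} (u : Fin t → E) (p q : E) :
    inner ℝ p (regOp c u q) = inner ℝ q (regOp c u p) := by
  simp only [inner_regOp, real_inner_comm q p, mul_comm (inner ℝ (u _) p)]

lemma le_inner_regOp (c : ℝ) {t : ℕ} (u : Fin t → E) (p : E) :
    c * ‖p‖ ^ 2 ≤ inner ℝ p (regOp c u p) := by
  rw [inner_regOp, real_inner_self_eq_norm_sq]
  have : 0 ≤ ∑ i, inner ℝ (u i) p * inner ℝ (u i) p :=
    Finset.sum_nonneg fun i _ => mul_self_nonneg _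
  linarith

lemma inner_regOp_nonneg {c : ℝ} (hc : 0 < c) {t : ℕ} (u : Fin t → E) (p : E) :
    0 ≤ inner ℝ p (regOp c u p) :=
  (by positivity : 0 ≤ c * ‖p‖ ^ 2).trans (le_inner_regOp c u p)

lemma regOp_injective {c : ℝ} (hc : 0 < c) {t : ℕ} (u : Fin t → E) :
    Function.Injective (regOp c u) := by
  refine (injective_iff_map_eq_zero _).2 fun p hp => ?_
  have h := le_inner_regOp c u p
  rw [hp, inner_zero_right] at h
  have h2 : ‖p‖ ^ 2 = 0 := le_antisymm (nonpos_of_mul_nonpos_right h hc) (by positivity)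
  simpa using h2

/-- A rank-one update is solved explicitly: correct the old preimage of `q` by a multiple of the old
preimage of `v`. The denominator is at least 1 by positivity. -/
lemma regOp_surjective {c : ℝ} (hc : 0 < c) {t : ℕ} (u : Fin t → E) :
    Function.Surjective (regOp c u) := by
  induction t with
  | zero => exact fun q => ⟨c⁻¹ • q, by simp [regOp_apply, smul_smul, hc.ne']⟩
  | succ t ih =>
    intro q
    set v := u (Fin.last t)
    set V := regOp c (fun i : Fin t => u i.castSucc)
    obtain ⟨a, ha⟩ := ih (fun i : Fin t => u i.castSucc) q
    obtain ⟨b, hb⟩ := ih (fun i : Fin t => u i.castSucc) v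
    have hpos : 0 ≤ inner ℝ v b := by
      rw [← hb, real_inner_comm]
      exact inner_regOp_nonneg hc _ _
    refine ⟨a - (inner ℝ v a / (1 + inner ℝ v b)) • b, ?_⟩
    rw [regOp_succ, map_sub, map_smul, ha, hb, inner_sub_right, inner_smul_right, sub_add,
      ← sub_smul]
    have : inner ℝ v a / (1 + inner ℝ v b)
        - (inner ℝ v a - inner ℝ v a / (1 + inner ℝ v b) * inner ℝ v b) = 0 := by
      field_simp
      ring
    rw [this, zero_smul, sub_zero]

variable [CompleteSpace E]

lemma isInvertible_regOp {c : ℝ} (hc : 0 < c) {t : ℕ} (u : Fin t → E) :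
    (regOp c u).IsInvertible :=
  ⟨ContinuousLinearEquiv.ofBijective (regOp c u)
    (LinearMap.ker_eq_bot.2 (regOp_injective hc u))
    (LinearMap.range_eq_top.2 (regOp_surjective hc u)), by ext; simp⟩

/-- The bilinear form `⟨p, (∑ uᵢ ⊗ uᵢ + c I)⁻¹ q⟩`. -/
def regForm (c : ℝ) {t : ℕ} (u : Fin t → E) (p q : E) : ℝ := inner ℝ p ((regOp c u).inverse q)

section

variable {c : ℝ} (hc : 0 < c) {t : ℕ} (u : Fin t → E)
include hc

lemma regOp_inverse (q : E) : regOp c u ((regOp c u).inverse q) = q :=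
  (isInvertible_regOp hc u).self_apply_inverse q

/-- Reduces evaluating the form to exhibiting a preimage. -/
lemma regForm_eq {p q r : E} (h : regOp c u r = q) : regForm c u p q = inner ℝ p r := by
  rw [regForm, (isInvertible_regOp hc u).inverse_apply_eq.2 h.symm]

lemma regForm_comm (p q : E) : regForm c u p q = regForm c u q p := by
  obtain ⟨a, rfl⟩ := regOp_surjective hc u p
  obtain ⟨b, rfl⟩ := regOp_surjective hc u q
  rw [regForm_eq hc u rfl, regForm_eq hc u rfl, real_inner_comm, inner_regOp_comm, real_inner_comm]

lemma regForm_self_nonneg (p : E) : 0 ≤ regForm c u p p := by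
  obtain ⟨a, rfl⟩ := regOp_surjective hc u p
  rw [regForm_eq hc u rfl, real_inner_comm]
  exact inner_regOp_nonneg hc u a

/-- Cauchy–Schwarz inequality for the pair of dual norms given by the regularized operator. -/
lemma inner_sq_le_regForm_mul (p q : E) :
    inner ℝ p q ^ 2 ≤ regForm c u p p * inner ℝ q (regOp c u q) := by
  obtain ⟨a, rfl⟩ := regOp_surjective hc u p
  rw [regForm_eq hc u rfl, real_inner_comm a (regOp c u a), real_inner_comm q]
  have hB := LinearMap.BilinForm.apply_sq_le_of_symm
    (LinearMap.mk₂ ℝ (fun x y : E => (inner ℝ x (regOp c u y) : ℝ))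
    (fun _ _ _ => inner_add_left ..) (fun _ _ _ => real_inner_smul_left ..)
    (fun _ _ _ => by simp [inner_add_right]) (fun _ _ _ => by simp [inner_smul_right]))
    (fun x => inner_regOp_nonneg hc u x) ⟨fun x y => by simpa using inner_regOp_comm c u x y⟩ q a
  simpa [mul_comm] using hB

lemma regForm_self_le (p : E) : regForm c u p p ≤ ‖p‖ ^ 2 / c := by
  obtain ⟨a, rfl⟩ := regOp_surjective hc u p
  rw [regForm_eq hc u rfl, le_div_iff₀ hc]
  set v := regOp c u a
  have h1 : c * ‖a‖ ^ 2 ≤ inner ℝ v a := by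
    rw [real_inner_comm]; exact le_inner_regOp c u a
  have h2 : inner ℝ v a ≤ ‖v‖ * ‖a‖ := real_inner_le_norm v a
  -- The square gives `2c‖v‖‖a‖ ≤ ‖v‖² + c²‖a‖²`, and `c²‖a‖² ≤ c⟨v, a⟩ ≤ c‖v‖‖a‖` absorbs the last
  -- term.
  nlinarith [sq_nonneg (‖v‖ - c * ‖a‖), norm_nonneg v, norm_nonneg a]

lemma sqrt_regForm_add_le (p q : E) :
    √(regForm c u (p + q) (p + q)) ≤ √(regForm c u p p) + √(regForm c u q q) := by
  have hp := regForm_self_nonneg hc u p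
  have hq := regForm_self_nonneg hc u q
  have hcs : regForm c u p q ≤ √(regForm c u p p) * √(regForm c u q q) := by
    rw [← Real.sqrt_mul hp]
    refine Real.le_sqrt_of_sq_le ?_
    -- The primal norm of `V⁻¹q` is the dual norm of `q`.
    have := inner_sq_le_regForm_mul hc u p ((regOp c u).inverse q)
    rwa [regOp_inverse hc u, real_inner_comm q] at this
  refine Real.sqrt_le_iff.2 ⟨by positivity, ?_⟩
  have hexp : regForm c u (p + q) (p + q)
      = regForm c u p p + 2 * regForm c u p q + regForm c u q q := by
    have := regForm_comm hc u p q
    simp only [regForm, map_add, inner_add_left, inner_add_right] at this ⊢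
    linarith
  rw [hexp]
  nlinarith [Real.sq_sqrt hp, Real.sq_sqrt hq]

end

/-- The Sherman–Morrison formula. -/
lemma regForm_succ {c : ℝ} (hc : 0 < c) {t : ℕ} (u : Fin (t + 1) → E) (p q : E) :
    regForm c u p q = regForm c (fun i : Fin t => u i.castSucc) p q
      - regForm c (fun i : Fin t => u i.castSucc) p (u (Fin.last t))
        * regForm c (fun i : Fin t => u i.castSucc) (u (Fin.last t)) q
        / (1 + regForm c (fun i : Fin t => u i.castSucc) (u (Fin.last t)) (u (Fin.last t))) := by
  set v := u (Fin.last t)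
  set w : Fin t → E := fun i => u i.castSucc
  have hw := regForm_self_nonneg hc w v
  set a := (regOp c w).inverse q
  set b := (regOp c w).inverse v
  have hb : regForm c w v v = inner ℝ v b := rfl
  have hq : regForm c w v q = inner ℝ v a := rfl
  have key : regOp c u (a - (inner ℝ v a / (1 + inner ℝ v b)) • b) = q := by
    rw [regOp_succ, map_sub, map_smul, regOp_inverse hc w, regOp_inverse hc w, inner_sub_right,
      inner_smul_right, sub_add, ← sub_smul]
    have : inner ℝ v a / (1 + inner ℝ v b)
        - (inner ℝ v a - inner ℝ v a / (1 + inner ℝ v b) * inner ℝ v b) = 0 := by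
      rw [hb] at hw
      field_simp
      ring
    rw [this, zero_smul, sub_zero]
  rw [regForm_eq hc u key, hb, hq, inner_sub_right, inner_smul_right]
  change _ = inner ℝ p a - inner ℝ p b * inner ℝ v a / _
  ring

/-- Update of the self-normalized quadratic form when one more vector is added. -/
lemma regForm_succ_add_smul {c : ℝ} (hc : 0 < c) {t : ℕ} (u : Fin (t + 1) → E) (p : E) (e : ℝ) :
    regForm c u (p + e • u (Fin.last t)) (p + e • u (Fin.last t))
      = regForm c (fun i : Fin t => u i.castSucc) p p
        + (e ^ 2 * regForm c (fun i : Fin t => u i.castSucc) (u (Fin.last t)) (u (Fin.last t))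
            + 2 * e * regForm c (fun i : Fin t => u i.castSucc) (u (Fin.last t)) p
            - regForm c (fun i : Fin t => u i.castSucc) (u (Fin.last t)) p ^ 2)
          / (1 + regForm c (fun i : Fin t => u i.castSucc) (u (Fin.last t)) (u (Fin.last t))) := by
  rw [regForm_succ hc]
  set v := u (Fin.last t)
  set w : Fin t → E := fun i => u i.castSucc
  have hw := regForm_self_nonneg hc w v
  have hs := regForm_comm hc w p v
  have e1 : regForm c w (p + e • v) (p + e • v)
      = regForm c w p p + 2 * e * regForm c w v p + e ^ 2 * regForm c w v v := by
    simp only [regForm, map_add, map_smul, inner_add_left, inner_add_right, inner_smul_left,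
      inner_smul_right] at hs ⊢
    simp only [RCLike.conj_to_real]
    rw [hs]; ring
  have e2 : regForm c w v (p + e • v) = regForm c w v p + e * regForm c w v v := by
    simp [regForm, inner_add_right, inner_smul_right]
  rw [regForm_comm hc w (p + e • v) v, e1, e2]
  field_simp
  ring

/-- The Gram matrix of a finite family. -/
def gramMat {t : ℕ} (u : Fin t → E) : Matrix (Fin t) (Fin t) ℝ :=
  Matrix.of fun i j => inner ℝ (u i) (u j)

omit [CompleteSpace E] in
lemma posSemidef_gramMat {t : ℕ} (u : Fin t → E) : (gramMat u).PosSemidef :=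
  Matrix.posSemidef_gram ℝ u

omit [CompleteSpace E] in
lemma isUnit_det_gramMat_add {c : ℝ} (hc : 0 < c) {t : ℕ} (u : Fin t → E) :
    IsUnit (gramMat u + c • (1 : Matrix (Fin t) (Fin t) ℝ)).det := by
  rw [← Matrix.isUnit_iff_isUnit_det]
  exact ((Matrix.PosDef.one.smul hc).posSemidef_add (posSemidef_gramMat u)).isUnit

/-- The posterior variance in terms of the Gram matrix. -/
lemma regForm_self_eq {c : ℝ} (hc : 0 < c) {t : ℕ} (u : Fin t → E) (w : E) :
    regForm c u w w = c⁻¹ * (inner ℝ w w - dotProduct (fun i => inner ℝ (u i) w)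
      (Matrix.mulVec (gramMat u + c • (1 : Matrix (Fin t) (Fin t) ℝ))⁻¹
        (fun i => inner ℝ (u i) w))) := by
  set k : Fin t → ℝ := fun i => inner ℝ (u i) w
  set A := gramMat u + c • (1 : Matrix (Fin t) (Fin t) ℝ)
  set v := Matrix.mulVec A⁻¹ k
  have hAv : Matrix.mulVec A v = k := by
    rw [Matrix.mulVec_mulVec, Matrix.mul_nonsing_inv _ (isUnit_det_gramMat_add hc u),
      Matrix.one_mulVec]
  have hAv' (i : Fin t) : ∑ j, inner ℝ (u i) (u j) * v j + c * v i = k i := by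
    rw [← congrFun hAv i]
    simp only [A, Matrix.add_mulVec, Matrix.smul_mulVec, Matrix.one_mulVec]
    simp [Matrix.mulVec, dotProduct, gramMat]
  -- The preimage of `w` is the kernel ridge residual divided by `c`: since `(K + cI)v = k`, its
  -- inner product with `u i` is `v i`.
  have key : regOp c u (c⁻¹ • (w - ∑ j, v j • u j)) = w := by
    rw [regOp_apply, smul_smul, mul_inv_cancel₀ hc.ne', one_smul]
    have h1 (i : Fin t) : inner ℝ (u i) (c⁻¹ • (w - ∑ j, v j • u j)) = v i := by
      rw [inner_smul_right, inner_sub_right, inner_sum]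
      simp only [inner_smul_right]
      have := hAv' i
      simp only [mul_comm (inner ℝ (u i) (u _))] at this
      change c⁻¹ * (k i - _) = _
      rw [← this]
      field_simp
      ring
    simp [h1]
  rw [regForm_eq hc u key, inner_smul_right, inner_sub_right, inner_sum]
  simp only [inner_smul_right, dotProduct, k, real_inner_comm, mul_comm]

/-- Schur complement of the last diagonal entry, identified through `regForm_self_eq`. -/
lemma det_one_add_gramMat_succ {c : ℝ} (hc : 0 < c) {t : ℕ} (u : Fin (t + 1) → E) :
    (1 + c⁻¹ • gramMat u).det
      = (1 + c⁻¹ • gramMat (fun i : Fin t => u i.castSucc)).det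
        * (1 + regForm c (fun i : Fin t => u i.castSucc) (u (Fin.last t)) (u (Fin.last t))) := by
  set w : Fin t → E := fun i => u i.castSucc with hw
  set v := u (Fin.last t) with hv
  set k : Fin t → ℝ := fun i => inner ℝ (w i) v with hk
  set A : Matrix (Fin t) (Fin t) ℝ := 1 + c⁻¹ • gramMat w with hA
  have hAc : A = c⁻¹ • (gramMat w + c • (1 : Matrix (Fin t) (Fin t) ℝ)) := by
    rw [hA, smul_add, smul_smul, inv_mul_cancel₀ hc.ne', one_smul, add_comm]
  have hdet := isUnit_det_gramMat_add hc w
  have hAunit : IsUnit A := by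
    rw [hAc, Matrix.isUnit_iff_isUnit_det, Matrix.det_smul]
    exact (IsUnit.mk0 _ (by positivity)).mul hdet
  have hAinv : A⁻¹ = c • (gramMat w + c • (1 : Matrix (Fin t) (Fin t) ℝ))⁻¹ := by
    refine Matrix.inv_eq_right_inv ?_
    rw [hAc, Matrix.smul_mul, Matrix.mul_smul, smul_smul, inv_mul_cancel₀ hc.ne', one_smul,
      Matrix.mul_nonsing_inv _ hdet]
  have := hAunit.invertible
  have hblock : (1 + c⁻¹ • gramMat u).submatrix (finSumFinEquiv (m := t) (n := 1))
      (finSumFinEquiv (m := t) (n := 1))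
      = Matrix.fromBlocks A (Matrix.of fun i _ => c⁻¹ * k i) (Matrix.of fun _ j => c⁻¹ * k j)
        (Matrix.of fun _ _ => 1 + c⁻¹ * inner ℝ v v) := by
    have hlast (i : Fin 1) : finSumFinEquiv (Sum.inr i : Fin t ⊕ Fin 1) = Fin.last t := by
      obtain rfl := Subsingleton.elim i 0
      rfl
    have hinit (i : Fin t) : finSumFinEquiv (Sum.inl i : Fin t ⊕ Fin 1) = i.castSucc := rfl
    ext i j
    rcases i with i | i <;> rcases j with j | j
    · simp [-finSumFinEquiv_apply_left, hinit, hA, gramMat, Matrix.one_apply, hw]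
    · simp [-finSumFinEquiv_apply_left, -finSumFinEquiv_apply_right, hinit, hlast, gramMat,
        hk, hw, hv, Fin.castSucc_ne_last]
    · simp [-finSumFinEquiv_apply_left, -finSumFinEquiv_apply_right, hinit, hlast, gramMat,
        hk, hw, hv, (Fin.castSucc_ne_last _).symm, real_inner_comm]
    · simp [-finSumFinEquiv_apply_right, hlast, gramMat, hv]
  rw [← Matrix.det_submatrix_equiv_self (finSumFinEquiv (m := t) (n := 1)), hblock,
    Matrix.det_fromBlocks₁₁, Matrix.det_fin_one, regForm_self_eq hc w v,
    Matrix.invOf_eq_nonsing_inv, hAinv]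
  congr 1
  rw [Matrix.sub_apply, Matrix.mul_assoc]
  change 1 + c⁻¹ * inner ℝ v v - dotProduct (c⁻¹ • k) (Matrix.mulVec
    (c • (gramMat w + c • (1 : Matrix (Fin t) (Fin t) ℝ))⁻¹) (c⁻¹ • k)) = _
  simp only [Matrix.smul_mulVec, Matrix.mulVec_smul, smul_dotProduct, dotProduct_smul, smul_eq_mul,
    ← hk]
  field_simp
  ring

end RegularizedOperator

/-! ### One step of the method of mixtures. -/

/-- For `|e| ≤ 1`, convexity bounds `exp(ex)` by the chord between `exp(-x)` and `exp x`. The noise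
has mean zero, so averaging leaves `cosh x`. The resulting variance proxy 1 is not optimal but is
all that `β_t` requires. -/
lemma bernoulli_mgf_le {p : ℝ} (hp : p ∈ Icc (0 : ℝ) 1) (x : ℝ) :
    p * Real.exp ((1 - p) * x) + (1 - p) * Real.exp (-p * x) ≤ Real.exp (x ^ 2 / 2) := by
  obtain ⟨h0, h1⟩ := hp
  have key (e : ℝ) (he : |e| ≤ 1) :
      Real.exp (e * x) ≤ (1 + e) / 2 * Real.exp x + (1 - e) / 2 * Real.exp (-x) := by
    obtain ⟨h2, h3⟩ := abs_le.1 he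
    have := convexOn_exp.2 (mem_univ x) (mem_univ (-x)) (by linarith : 0 ≤ (1 + e) / 2)
      (by linarith : 0 ≤ (1 - e) / 2) (by ring)
    simp only [smul_eq_mul] at this
    rwa [show (1 + e) / 2 * x + (1 - e) / 2 * -x = e * x by ring] at this
  have k1 := key (1 - p) (abs_le.2 ⟨by linarith, by linarith⟩)
  have k2 := key (-p) (abs_le.2 ⟨by linarith, by linarith⟩)
  have h := Real.cosh_le_exp_half_sq x
  rw [Real.cosh_eq] at h
  nlinarith [mul_le_mul_of_nonneg_left k1 h0, mul_le_mul_of_nonneg_left k2 (sub_nonneg.2 h1)]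

/-- The logarithm of the increment of the self-normalized exponential supermartingale, before
division by the determinant factor. -/
def mixExponent (a w e : ℝ) : ℝ := (e ^ 2 * w + 2 * e * a - a ^ 2) / (1 + w) / 2

/-- Completing the square in `v`. With `z = a + √w v`, the factor `exp(-z²/2)` is there to cancel
the bound `exp(z²/2)` on the moment generating function. -/
lemma exp_mul_gaussian_eq (a : ℝ) {w : ℝ} (hw : 0 ≤ w) (e v : ℝ) :
    Real.exp (e * (a + √w * v)) * Real.exp (-(a + √w * v) ^ 2 / 2 - v ^ 2 / 2)
      = Real.exp (mixExponent a w e)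
        * Real.exp (-((1 + w) / 2) * (v - (e - a) * √w / (1 + w)) ^ 2) := by
  rw [← Real.exp_add, ← Real.exp_add, mixExponent]
  congr 1
  have h := Real.sq_sqrt hw
  generalize √w = r at h
  subst h
  field_simp
  ring

lemma integrable_exp_mul_gaussian (a : ℝ) {w : ℝ} (hw : 0 ≤ w) (e : ℝ) :
    Integrable fun v => Real.exp (e * (a + √w * v))
      * Real.exp (-(a + √w * v) ^ 2 / 2 - v ^ 2 / 2) := by
  simp_rw [exp_mul_gaussian_eq a hw]
  exact ((integrable_exp_neg_mul_sq (by positivity : 0 < (1 + w) / 2)).comp_sub_right _).const_mul _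

lemma integral_exp_mul_gaussian (a : ℝ) {w : ℝ} (hw : 0 ≤ w) (e : ℝ) :
    ∫ v, Real.exp (e * (a + √w * v)) * Real.exp (-(a + √w * v) ^ 2 / 2 - v ^ 2 / 2)
      = Real.exp (mixExponent a w e) * √(Real.pi / ((1 + w) / 2)) := by
  simp_rw [exp_mul_gaussian_eq a hw]
  rw [integral_const_mul,
    integral_sub_right_eq_self (fun v : ℝ => Real.exp (-((1 + w) / 2) * v ^ 2)), integral_gaussian]

/-- One step of the method of mixtures for centred Bernoulli noise. -/
lemma bernoulli_mixture_le {p : ℝ} (hp : p ∈ Icc (0 : ℝ) 1) (a : ℝ) {w : ℝ} (hw : 0 ≤ w) :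
    p * Real.exp (mixExponent a w (1 - p)) + (1 - p) * Real.exp (mixExponent a w (-p))
      ≤ √(1 + w) := by
  have h1 := (integrable_exp_mul_gaussian a hw (1 - p)).const_mul p
  have h2 := (integrable_exp_mul_gaussian a hw (-p)).const_mul (1 - p)
  have h3 : Integrable fun v : ℝ => Real.exp (-(1 / 2) * v ^ 2) :=
    integrable_exp_neg_mul_sq (by norm_num)
  -- Pointwise in `v`, the average over the noise is at most `exp(-v²/2)`. Integrating produces
  -- `√(2π/(1+w))` on the left and `√(2π)` on the right.
  have h := integral_mono (h1.add h2) h3 fun v => ?_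
  · simp only [Pi.add_apply] at h
    rw [integral_add h1 h2, integral_const_mul, integral_const_mul,
      integral_exp_mul_gaussian a hw, integral_exp_mul_gaussian a hw, integral_gaussian] at h
    have e1 : √(Real.pi / (1 / 2)) = √(1 + w) * √(Real.pi / ((1 + w) / 2)) := by
      rw [← Real.sqrt_mul (by positivity)]
      congr 1
      field_simp
    have hpos : 0 < √(Real.pi / ((1 + w) / 2)) := Real.sqrt_pos.2 (by positivity)
    rw [e1] at h
    refine le_of_mul_le_mul_right ?_ hpos
    linarith
  · set z := a + √w * v
    have hz := bernoulli_mgf_le hp z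
    have e2 : Real.exp (-(1 / 2) * v ^ 2)
        = Real.exp (z ^ 2 / 2) * Real.exp (-z ^ 2 / 2 - v ^ 2 / 2) := by
      rw [← Real.exp_add]
      ring_nf
    change p * (Real.exp ((1 - p) * z) * Real.exp (-z ^ 2 / 2 - v ^ 2 / 2))
      + (1 - p) * (Real.exp (-p * z) * Real.exp (-z ^ 2 / 2 - v ^ 2 / 2)) ≤ _
    rw [e2]
    nlinarith [mul_le_mul_of_nonneg_right hz (Real.exp_pos (-z ^ 2 / 2 - v ^ 2 / 2)).le]

/-! ### Sigmoid estimates on `[-B, B]`. -/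

lemma sigmoidDeriv_pos (a : ℝ) : 0 < sigmoidDeriv a :=
  mul_pos (Real.sigmoid_pos a) (sub_pos.2 (Real.sigmoid_lt_one a))

lemma continuous_sigmoidDeriv : Continuous sigmoidDeriv := by
  unfold sigmoidDeriv
  fun_prop

lemma sigmoidDeriv_le_lipConst {B a : ℝ} (ha : a ∈ Icc (-B) B) : sigmoidDeriv a ≤ lipConst B := by
  refine le_ciSup (f := fun a : Icc (-B) B => sigmoidDeriv a) ?_ ⟨a, ha⟩
  exact IsCompact.bddAbove (isCompact_range (continuous_sigmoidDeriv.comp continuous_subtype_val))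

lemma inv_sigmoidDeriv_le_kappa {B a : ℝ} (ha : a ∈ Icc (-B) B) :
    1 / sigmoidDeriv a ≤ kappa B := by
  refine le_ciSup (f := fun a : Icc (-B) B => 1 / sigmoidDeriv a) ?_ ⟨a, ha⟩
  refine IsCompact.bddAbove (isCompact_range ?_)
  exact continuous_const.div (continuous_sigmoidDeriv.comp continuous_subtype_val)
    fun a => (sigmoidDeriv_pos _).ne'

lemma kappa_pos {B : ℝ} (hB : 0 ≤ B) : 0 < kappa B :=
  (one_div_pos.2 (sigmoidDeriv_pos 0)).trans_le (inv_sigmoidDeriv_le_kappa ⟨by simpa, hB⟩)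

lemma lipConst_pos {B : ℝ} (hB : 0 ≤ B) : 0 < lipConst B :=
  (sigmoidDeriv_pos 0).trans_le (sigmoidDeriv_le_lipConst ⟨by simpa, hB⟩)

lemma abs_sigmoid_sub_le {B a b : ℝ} (ha : a ∈ Icc (-B) B) (hb : b ∈ Icc (-B) B) :
    |Real.sigmoid a - Real.sigmoid b| ≤ lipConst B * |a - b| :=
  (convex_Icc (-B) B).norm_image_sub_le_of_norm_hasDerivWithin_le (f := Real.sigmoid)
    (f' := sigmoidDeriv) (fun x _ => (Real.hasDerivAt_sigmoid x).hasDerivWithinAt)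
    (fun x hx => by
      rw [Real.norm_of_nonneg (sigmoidDeriv_pos x).le]
      exact sigmoidDeriv_le_lipConst hx) hb ha

/-- Mean value theorem with `s' ≥ 1/κ`; the source of the strong monotonicity of `g_t`. -/
lemma sq_le_kappa_mul_sigmoid_sub {B a b : ℝ} (ha : a ∈ Icc (-B) B) (hb : b ∈ Icc (-B) B) :
    (a - b) ^ 2 ≤ kappa B * ((Real.sigmoid a - Real.sigmoid b) * (a - b)) := by
  wlog hab : b ≤ a generalizing a b
  · have := this hb ha (le_of_not_ge hab)
    linarith
  have hκ : 0 < kappa B := kappa_pos (by linarith [ha.1, ha.2])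
  have h := (convex_Icc (-B) B).mul_sub_le_image_sub_of_le_deriv (f := Real.sigmoid)
    (C := (kappa B)⁻¹) continuous_sigmoid.continuousOn
    differentiable_sigmoid.differentiableOn (fun x hx => ?_) b hb a ha hab
  · have h2 := mul_le_mul_of_nonneg_left h hκ.le
    rw [← mul_assoc, mul_inv_cancel₀ hκ.ne', one_mul] at h2
    nlinarith [sub_nonneg.2 hab]
  · rw [Real.deriv_sigmoid]
    rw [interior_Icc] at hx
    have := inv_sigmoidDeriv_le_kappa (Ioo_subset_Icc_self hx)
    rw [one_div] at this
    exact inv_le_of_inv_le₀ (sigmoidDeriv_pos x) this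

/-! ### Maximal inequality for nonnegative supermartingales. -/

section Ville

variable {Ω : Type*} {m : MeasurableSpace Ω} {P : Measure Ω} [IsProbabilityMeasure P]

lemma mul_measureReal_add_setIntegral_le {g : Ω → ℝ} (hg : Integrable g P) (hgm : Measurable g)
    {a : ℝ} {C : Set Ω} (hC : MeasurableSet C) :
    a * P.real (C ∩ {ω | a ≤ g ω}) + ∫ ω in C \ {ω | a ≤ g ω}, g ω ∂P ≤ ∫ ω in C, g ω ∂P := by
  have hS : MeasurableSet {ω | a ≤ g ω} := measurableSet_le measurable_const hgm
  rw [← integral_inter_add_sdiff (s := C) hS hg.integrableOn]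
  have := setIntegral_mono_on (f := fun _ => a) (g := g) (integrableOn_const (by simp))
    (hg.integrableOn (s := C ∩ {ω | a ≤ g ω})) (hC.inter hS) fun ω hω => hω.2
  rw [setIntegral_const, smul_eq_mul] at this
  linarith

/-- **Ville's inequality** for nonnegative supermartingales. -/
lemma mul_measureReal_exists_le_integral {ℱ : Filtration ℕ m} {M : ℕ → Ω → ℝ}
    (hM : Supermartingale M ℱ P) (h0 : ∀ n ω, 0 ≤ M n ω) {a : ℝ} (ha : 0 < a) :
    a * P.real {ω | ∃ n, a ≤ M n ω} ≤ ∫ ω, M 0 ω ∂P := by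
  have hmeas (n : ℕ) : Measurable (M n) := (hM.stronglyMeasurable n).measurable.mono (ℱ.le n) le_rfl
  set A : ℕ → Set Ω := fun n => {ω | ∃ k ≤ n, a ≤ M k ω} with hA
  have hAm (n : ℕ) : MeasurableSet[ℱ n] (A n) := by
    have : A n = ⋃ k ∈ Finset.range (n + 1), {ω | a ≤ M k ω} := by
      ext ω
      simp [hA]
    rw [this]
    refine Finset.measurableSet_biUnion _ fun k hk => ℱ.mono (Finset.mem_range_succ_iff.1 hk) _ ?_
    exact (hM.stronglyMeasurable k).measurable measurableSet_Ici
  -- Optional stopping at the first crossing, without stopping times: paths that have crossed are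
  -- frozen at value `a`, the others keep evolving.
  have hfin (n : ℕ) : a * P.real (A n) + ∫ ω in (A n)ᶜ, M n ω ∂P ≤ ∫ ω, M 0 ω ∂P := by
    induction n with
    | zero =>
      have h := mul_measureReal_add_setIntegral_le (hM.integrable 0) (hmeas 0) (a := a)
        MeasurableSet.univ
      have e1 : A 0 = {ω | a ≤ M 0 ω} := by ext ω; simp [hA]
      rw [univ_inter, setIntegral_univ, ← compl_eq_univ_sdiff, ← e1] at h
      exact h
    | succ n ih =>
      have hAn := ℱ.le n _ (hAm n)
      have h := mul_measureReal_add_setIntegral_le (hM.integrable (n + 1)) (hmeas (n + 1)) (a := a)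
        hAn.compl
      have hS := hM.setIntegral_le (Nat.le_succ n) (hAm n).compl
      have e1 : A (n + 1) = A n ∪ ((A n)ᶜ ∩ {ω | a ≤ M (n + 1) ω}) := by
        rw [union_inter_distrib_left, union_compl_self, univ_inter]
        ext ω
        simp only [hA, mem_ofPred_eq, mem_union, Nat.le_succ_iff]
        constructor
        · rintro ⟨k, hk | rfl, h⟩
          exacts [Or.inl ⟨k, hk, h⟩, Or.inr h]
        · rintro (⟨k, hk, h⟩ | h)
          exacts [⟨k, Or.inl hk, h⟩, ⟨_, Or.inr rfl, h⟩]
      have e2 : (A (n + 1))ᶜ = (A n)ᶜ \ {ω | a ≤ M (n + 1) ω} := by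
        rw [e1, compl_union, compl_inter, compl_compl, inter_union_distrib_left,
          compl_inter_self, empty_union, sdiff_eq]
      have hle : P.real (A (n + 1)) ≤ P.real (A n) + P.real ((A n)ᶜ ∩ {ω | a ≤ M (n + 1) ω}) := by
        rw [e1]
        exact measureReal_union_le _ _
      rw [e2]
      nlinarith [mul_le_mul_of_nonneg_left hle ha.le]
  have hU : {ω | ∃ n, a ≤ M n ω} = ⋃ n, A n := by
    ext ω
    simp only [hA, mem_ofPred_eq, mem_iUnion]
    exact ⟨fun ⟨n, h⟩ => ⟨n, n, le_rfl, h⟩, fun ⟨_, k, _, h⟩ => ⟨k, h⟩⟩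
  have hmono : Monotone A := fun i j hij ω ⟨k, hk, h⟩ => ⟨k, hk.trans hij, h⟩
  have hlim : Filter.Tendsto (fun n => P.real (A n)) Filter.atTop (nhds (P.real (⋃ n, A n))) :=
    (ENNReal.tendsto_toReal (measure_ne_top _ _)).comp (tendsto_measure_iUnion_atTop hmono)
  rw [hU]
  refine le_of_tendsto (hlim.const_mul a) (Filter.Eventually.of_forall fun n => ?_)
  have : 0 ≤ ∫ ω in (A n)ᶜ, M n ω ∂P := integral_nonneg fun ω => h0 n ω
  linarith [hfin n]

end Ville

/-! ### Anytime self-normalized concentration. -/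

section SelfNormalized

variable {E : Type*} [NormedAddCommGroup E] [InnerProductSpace ℝ E] [CompleteSpace E]

/-- The weighted sum `∑_{i < t} eᵢ uᵢ`. -/
def noiseSum (u : ℕ → E) (e : ℕ → ℝ) (t : ℕ) : E := ∑ i ∈ Finset.range t, e i • u i

/-- The exponential process `exp (½ ‖S_t‖²_{V_t⁻¹}) / √det (I + c⁻¹ K_t)`. -/
def expProc (c : ℝ) (u : ℕ → E) (e : ℕ → ℝ) (t : ℕ) : ℝ :=
  Real.exp (regForm c (fun i : Fin t => u i) (noiseSum u e t) (noiseSum u e t) / 2)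
    / √(1 + c⁻¹ • gramMat fun i : Fin t => u i).det

lemma one_le_det_one_add_gramMat {c : ℝ} (hc : 0 < c) {t : ℕ} (u : Fin t → E) :
    1 ≤ (1 + c⁻¹ • gramMat u).det := by
  induction t with
  | zero => simp
  | succ t ih =>
    rw [det_one_add_gramMat_succ hc]
    have := regForm_self_nonneg hc (fun i : Fin t => u i.castSucc) (u (Fin.last t))
    exact one_le_mul_of_one_le_of_one_le (ih _) (by linarith)

omit [CompleteSpace E] in
lemma expProc_zero (c : ℝ) (u : ℕ → E) (e : ℕ → ℝ) : expProc c u e 0 = 1 := by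
  simp [expProc, noiseSum, regForm]

omit [CompleteSpace E] in
lemma expProc_nonneg (c : ℝ) (u : ℕ → E) (e : ℕ → ℝ) (t : ℕ) : 0 ≤ expProc c u e t := by
  unfold expProc
  positivity

/-- Isolates the newest noise term `e t` in a single scalar factor. -/
lemma expProc_succ {c : ℝ} (hc : 0 < c) (u : ℕ → E) (e : ℕ → ℝ) (t : ℕ) :
    expProc c u e (t + 1) = expProc c u e t
      * (Real.exp (mixExponent (regForm c (fun i : Fin t => u i) (u t) (noiseSum u e t))
          (regForm c (fun i : Fin t => u i) (u t) (u t)) (e t))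
        / √(1 + regForm c (fun i : Fin t => u i) (u t) (u t))) := by
  have h1 := regForm_succ_add_smul hc (fun i : Fin (t + 1) => u i) (noiseSum u e t) (e t)
  have h2 := det_one_add_gramMat_succ hc (fun i : Fin (t + 1) => u i)
  simp only [Fin.val_last, Fin.val_castSucc] at h1 h2
  have h3 := one_le_det_one_add_gramMat hc (fun i : Fin t => u i)
  have h4 : noiseSum u e (t + 1) = noiseSum u e t + e t • u t := Finset.sum_range_succ ..
  rw [expProc, expProc, h4, h1, h2, Real.sqrt_mul (by linarith), div_mul_div_comm, ← Real.exp_add,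
    mixExponent, add_div]

/-- A crude deterministic bound, serving only integrability. -/
lemma expProc_le {c : ℝ} (hc : 0 < c) {u : ℕ → E} (hu : ∀ i, ‖u i‖ ≤ 1) {e : ℕ → ℝ}
    (he : ∀ i, |e i| ≤ 1) (t : ℕ) : expProc c u e t ≤ Real.exp ((t : ℝ) ^ 2 / c / 2) := by
  have h1 := one_le_det_one_add_gramMat hc (fun i : Fin t => u i)
  have h2 : ‖noiseSum u e t‖ ≤ t := by
    refine (norm_sum_le _ _).trans ((Finset.sum_le_sum fun i _ => ?_).trans
      (by simp : ∑ _i ∈ Finset.range t, (1 : ℝ) ≤ t))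
    rw [norm_smul]
    exact mul_le_one₀ (he i) (norm_nonneg _) (hu i)
  have h3 := regForm_self_le hc (fun i : Fin t => u i) (noiseSum u e t)
  refine (div_le_self (Real.exp_pos _).le (Real.one_le_sqrt.2 h1)).trans (Real.exp_le_exp.2 ?_)
  gcongr
  exact h3.trans (by gcongr)

omit [CompleteSpace E] in
lemma expProc_congr {c : ℝ} {u : ℕ → E} {e e' : ℕ → ℝ} {t : ℕ} (h : ∀ i < t, e i = e' i) :
    expProc c u e t = expProc c u e' t := by
  have : noiseSum u e t = noiseSum u e' t :=
    Finset.sum_congr rfl fun i hi => by rw [h i (Finset.mem_range.1 hi)]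
  rw [expProc, expProc, this]

omit [CompleteSpace E] in
lemma noiseSum_congr {u : ℕ → E} {e e' : ℕ → ℝ} {t : ℕ} (h : ∀ i < t, e i = e' i) :
    noiseSum u e t = noiseSum u e' t :=
  Finset.sum_congr rfl fun i hi => by rw [h i (Finset.mem_range.1 hi)]

/-- Averaging the exponential process over centred Bernoulli noise does not increase it. -/
lemma expProc_update_le {c : ℝ} (hc : 0 < c) (u : ℕ → E) (e : ℕ → ℝ) (t : ℕ) {p : ℝ}
    (hp : p ∈ Icc (0 : ℝ) 1) :
    p * expProc c u (Function.update e t (1 - p)) (t + 1)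
      + (1 - p) * expProc c u (Function.update e t (0 - p)) (t + 1) ≤ expProc c u e t := by
  have hcong (q : ℝ) : ∀ i < t, Function.update e t q i = e i := fun i hi =>
    Function.update_of_ne hi.ne _ _
  simp only [expProc_succ hc, expProc_congr (hcong _), noiseSum_congr (hcong _),
    Function.update_self, zero_sub]
  set w := regForm c (fun i : Fin t => u i) (u t) (u t)
  set a := regForm c (fun i : Fin t => u i) (u t) (noiseSum u e t)
  have hw : 0 ≤ w := regForm_self_nonneg hc _ _
  have h := bernoulli_mixture_le hp a hw
  have hs : 0 < √(1 + w) := Real.sqrt_pos.2 (by linarith)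
  calc _ = expProc c u e t * ((p * Real.exp (mixExponent a w (1 - p))
        + (1 - p) * Real.exp (mixExponent a w (-p))) / √(1 + w)) := by ring
    _ ≤ expProc c u e t * 1 :=
        mul_le_mul_of_nonneg_left ((div_le_one hs).2 h) (expProc_nonneg ..)
    _ = _ := mul_one _

section Measurability

variable {Ω : Type*} {𝒢 : MeasurableSpace Ω} {c : ℝ} (hc : 0 < c)
include hc

/-- `E` carries no σ-algebra and need not be separable, so measurability is phrased through scalar
inner products. Sherman–Morrison makes the form a rational function of them. -/
lemma measurable_regForm (u : ℕ → Ω → E) (t : ℕ)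
    (hu : ∀ i < t, ∀ j < t, Measurable fun ω => inner ℝ (u i ω) (u j ω)) (z z' : Ω → E)
    (hz : Measurable fun ω => inner ℝ (z ω) (z' ω))
    (hzu : ∀ i < t, Measurable fun ω => inner ℝ (z ω) (u i ω))
    (hzu' : ∀ i < t, Measurable fun ω => inner ℝ (u i ω) (z' ω)) :
    Measurable fun ω => regForm c (fun i : Fin t => u i ω) (z ω) (z' ω) := by
  induction t generalizing z z' with
  | zero =>
    have (ω : Ω) : regForm c (fun i : Fin 0 => u i ω) (z ω) (z' ω)
        = c⁻¹ * inner ℝ (z ω) (z' ω) := by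
      rw [regForm_eq hc (r := c⁻¹ • z' ω) _ (by simp [regOp_apply, smul_smul, hc.ne']),
        inner_smul_right]
    simp_rw [this]
    exact hz.const_mul _
  | succ t ih =>
    simp_rw [regForm_succ hc, Fin.val_last, Fin.val_castSucc]
    have hu' : ∀ i < t, ∀ j < t, Measurable fun ω => inner ℝ (u i ω) (u j ω) :=
      fun i hi j hj => hu i (hi.trans t.lt_succ_self) j (hj.trans t.lt_succ_self)
    have hL : ∀ i < t, Measurable fun ω => inner ℝ (u i ω) (u t ω) :=
      fun i hi => hu i (hi.trans t.lt_succ_self) t t.lt_succ_self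
    have hR : ∀ i < t, Measurable fun ω => inner ℝ (u t ω) (u i ω) :=
      fun i hi => hu t t.lt_succ_self i (hi.trans t.lt_succ_self)
    have hZ : ∀ i < t, Measurable fun ω => inner ℝ (z ω) (u i ω) :=
      fun i hi => hzu i (hi.trans t.lt_succ_self)
    have hZ' : ∀ i < t, Measurable fun ω => inner ℝ (u i ω) (z' ω) :=
      fun i hi => hzu' i (hi.trans t.lt_succ_self)
    have m1 := ih hu' z z' hz hZ hZ'
    have m2 := ih hu' z (u t) (hzu t t.lt_succ_self) hZ hL
    have m3 := ih hu' (u t) z' (hzu' t t.lt_succ_self) hR hZ'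
    have m4 := ih hu' (u t) (u t) (hu t t.lt_succ_self t t.lt_succ_self) hR hL
    exact m1.sub ((m2.mul m3).div (m4.const_add 1))

lemma measurable_expProc (u : ℕ → Ω → E) (e : ℕ → Ω → ℝ) (t : ℕ)
    (hu : ∀ i < t, ∀ j < t, Measurable fun ω => inner ℝ (u i ω) (u j ω))
    (he : ∀ i < t, Measurable (e i)) :
    Measurable fun ω => expProc c (fun i => u i ω) (fun i => e i ω) t := by
  unfold expProc
  refine ((Measurable.div_const ?_ 2).exp).div (Measurable.sqrt ?_)
  · have (ω : Ω) : regForm c (fun i : Fin t => u i ω) (noiseSum (fun i => u i ω) (fun i => e i ω) t)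
        (noiseSum (fun i => u i ω) (fun i => e i ω) t)
        = ∑ i ∈ Finset.range t, ∑ j ∈ Finset.range t,
          e i ω * (e j ω * regForm c (fun i : Fin t => u i ω) (u i ω) (u j ω)) := by
      simp only [regForm, noiseSum, map_sum, map_smul, sum_inner, inner_sum, inner_smul_left,
        inner_smul_right, RCLike.conj_to_real, Finset.mul_sum]
      rw [Finset.sum_comm]
      exact Finset.sum_congr rfl fun i _ => Finset.sum_congr rfl fun j _ => by ring
    simp_rw [this]
    refine Finset.measurable_sum _ fun i hi => Finset.measurable_sum _ fun j hj => ?_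
    rw [Finset.mem_range] at hi hj
    exact (he i hi).mul ((he j hj).mul (measurable_regForm hc u t hu _ _ (hu i hi j hj)
      (fun k hk => hu i hi k hk) fun k hk => hu k hk j hj))
  · clear he
    induction t with
    | zero => simp
    | succ t ih =>
      simp_rw [det_one_add_gramMat_succ hc, Fin.val_last, Fin.val_castSucc]
      have hlt : ∀ i < t, i < t + 1 := fun i hi => hi.trans t.lt_succ_self
      have hu' : ∀ i < t, ∀ j < t, Measurable fun ω => inner ℝ (u i ω) (u j ω) :=
        fun i hi j hj => hu i (hlt i hi) j (hlt j hj)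
      exact (ih hu').mul ((measurable_regForm hc u t hu' _ _ (hu t t.lt_succ_self t t.lt_succ_self)
        (fun i hi => hu t t.lt_succ_self i (hlt i hi))
        (fun i hi => hu i (hlt i hi) t t.lt_succ_self)).const_add 1)

end Measurability

variable {Ω : Type*} {m : MeasurableSpace Ω} {P : Measure Ω} [IsProbabilityMeasure P]
  {ℱ : Filtration ℕ m} {c : ℝ} {u : ℕ → Ω → E} {p y : ℕ → Ω → ℝ}

/-- The exponential process of Bernoulli noise is a supermartingale. -/
lemma supermartingale_expProc (hc : 0 < c) (hu1 : ∀ i ω, ‖u i ω‖ ≤ 1)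
    (hu : ∀ t, ∀ i ≤ t, ∀ j ≤ t, Measurable[ℱ t] fun ω => inner ℝ (u i ω) (u j ω))
    (hp : ∀ t, Measurable[ℱ t] (p t)) (hp01 : ∀ t ω, p t ω ∈ Icc (0 : ℝ) 1)
    (hy : ∀ t, Measurable[ℱ (t + 1)] (y t)) (hy01 : ∀ t ω, y t ω = 0 ∨ y t ω = 1)
    (hyp : ∀ t, P⟦{ω | y t ω = 1} | ℱ t⟧ =ᵐ[P] p t) :
    Supermartingale (fun t ω => expProc c (fun i => u i ω) (fun i => y i ω - p i ω) t) ℱ P := by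
  set e : ℕ → Ω → ℝ := fun i ω => y i ω - p i ω with he
  -- The noise of index `i` is known at time `i + 1`, and the process at `t` uses only indices below
  -- `t`; hence it is adapted.
  have hem (t : ℕ) : ∀ i < t, Measurable[ℱ t] (e i) := fun i hi =>
    ((hy i).mono (ℱ.mono (Nat.succ_le_of_lt hi)) le_rfl).sub
      ((hp i).mono (ℱ.mono hi.le) le_rfl)
  have hem' (t : ℕ) : Measurable (e t) :=
    (hem (t + 1) t t.lt_succ_self).mono (ℱ.le _) le_rfl
  have he1 (t : ℕ) (ω : Ω) : |e t ω| ≤ 1 := by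
    obtain ⟨h0, h1⟩ := hp01 t ω
    rcases hy01 t ω with h | h <;> simp only [he, h] <;>
      exact abs_le.2 ⟨by linarith, by linarith⟩
  have hbdd {g : Ω → ℝ} (hg : Measurable g) {C : ℝ} (h0 : ∀ ω, 0 ≤ g ω) (hC : ∀ ω, g ω ≤ C) :
      Integrable g P :=
    Integrable.of_bound hg.aestronglyMeasurable C
      (Filter.Eventually.of_forall fun ω => by rw [Real.norm_of_nonneg (h0 ω)]; exact hC ω)
  have hM (t : ℕ) : Measurable[ℱ t] fun ω => expProc c (fun i => u i ω) (fun i => e i ω) t :=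
    measurable_expProc hc u e t (fun i hi j hj => hu t i hi.le j hj.le) (hem t)
  refine supermartingale_nat (fun t => (hM t).stronglyMeasurable)
    (fun t => hbdd ((hM t).mono (ℱ.le t) le_rfl) (fun ω => expProc_nonneg ..)
      fun ω => expProc_le hc (fun i => hu1 i ω) (fun i => he1 i ω) t) fun t => ?_
  -- The next value of the process if the pending feedback were `b`. It is `ℱ t`-measurable, so only
  -- the indicator `Y` below is averaged.
  set U : ℝ → Ω → ℝ := fun b ω =>
    expProc c (fun i => u i ω) (Function.update (fun i => e i ω) t (b - p t ω)) (t + 1) with hU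
  have hUm (b : ℝ) : Measurable[ℱ t] (U b) := by
    have := measurable_expProc (𝒢 := ℱ t) hc u
      (Function.update e t (fun ω => b - p t ω)) (t + 1)
      (fun i hi j hj => hu t i (Nat.lt_succ_iff.1 hi) j (Nat.lt_succ_iff.1 hj)) fun i hi => ?_
    · convert this using 3 with ω
      ext i
      by_cases h : i = t
      · subst h; simp
      · simp [h]
    · by_cases h : i = t
      · subst h
        simpa using (hp i).const_sub b
      · rw [Function.update_of_ne h]
        exact hem t i (by omega)
  have hUi (b : ℝ) (hb : b = 0 ∨ b = 1) : Integrable (U b) P := by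
    refine hbdd ((hUm b).mono (ℱ.le t) le_rfl) (fun ω => expProc_nonneg ..)
      fun ω => expProc_le hc (fun i => hu1 i ω) (fun i => ?_) (t + 1)
    by_cases h : i = t
    · subst h
      obtain ⟨h0, h1⟩ := hp01 i ω
      rw [Function.update_self]
      rcases hb with rfl | rfl <;> exact abs_le.2 ⟨by linarith, by linarith⟩
    · rw [Function.update_of_ne h]
      exact he1 i ω
  set Y : Ω → ℝ := {ω | y t ω = 1}.indicator fun _ => (1 : ℝ) with hY
  have hS : MeasurableSet {ω | y t ω = 1} :=
    ((hy t).mono (ℱ.le _) le_rfl) (measurableSet_singleton 1)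
  have hYi : Integrable Y P := (integrable_const 1).indicator hS
  have hdec : (fun ω => expProc c (fun i => u i ω) (fun i => e i ω) (t + 1))
      = Y * (U 1 - U 0) + U 0 := by
    ext ω
    have hupd : expProc c (fun i => u i ω) (fun i => e i ω) (t + 1) = U (y t ω) ω := by
      simp only [hU]
      congr 1
      exact (Function.update_eq_self t (fun i => e i ω)).symm
    rw [hupd]
    rcases hy01 t ω with h | h <;> simp [hY, h]
  have hYU : Integrable (Y * (U 1 - U 0)) P := by
    refine ((hUi 1 (.inr rfl)).sub (hUi 0 (.inl rfl))).bdd_mul (c := 1)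
      (hYi.aestronglyMeasurable) (Filter.Eventually.of_forall fun ω => ?_)
    simp only [hY, indicator]
    split_ifs <;> simp
  change P[fun ω => expProc c (fun i => u i ω) (fun i => e i ω) (t + 1) | ℱ t] ≤ᵐ[P] _
  rw [hdec]
  have c1 := condExp_add hYU (hUi 0 (.inl rfl)) (ℱ t)
  have c2 := condExp_mul_of_stronglyMeasurable_right (μ := P) (m := ℱ t) (f := Y)
    ((hUm 1).sub (hUm 0)).stronglyMeasurable hYU hYi
  have c3 := condExp_of_stronglyMeasurable (ℱ.le t) (hUm 0).stronglyMeasurable (hUi 0 (.inl rfl))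
  filter_upwards [c1, c2, hyp t] with ω h1 h2 h3
  rw [h1, Pi.add_apply, h2, c3, Pi.mul_apply, h3]
  have := expProc_update_le hc (fun i => u i ω) (fun i => e i ω) t (hp01 t ω)
  change p t ω * U 1 ω + (1 - p t ω) * U 0 ω ≤ _ at this
  simp only [Pi.sub_apply]
  linarith

/-- Anytime self-normalized concentration for Bernoulli noise. -/
lemma le_measureReal_forall_expProc_lt (hc : 0 < c) (hu1 : ∀ i ω, ‖u i ω‖ ≤ 1)
    (hu : ∀ t, ∀ i ≤ t, ∀ j ≤ t, Measurable[ℱ t] fun ω => inner ℝ (u i ω) (u j ω))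
    (hp : ∀ t, Measurable[ℱ t] (p t)) (hp01 : ∀ t ω, p t ω ∈ Icc (0 : ℝ) 1)
    (hy : ∀ t, Measurable[ℱ (t + 1)] (y t)) (hy01 : ∀ t ω, y t ω = 0 ∨ y t ω = 1)
    (hyp : ∀ t, P⟦{ω | y t ω = 1} | ℱ t⟧ =ᵐ[P] p t) {δ : ℝ} (hδ : 0 < δ) :
    1 - δ ≤ P.real {ω | ∀ t,
      expProc c (fun i => u i ω) (fun i => y i ω - p i ω) t < 1 / δ} := by
  have hM := supermartingale_expProc hc hu1 hu hp hp01 hy hy01 hyp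
  -- Ville at level `1/δ`; the process starts at 1.
  have h := mul_measureReal_exists_le_integral hM (fun t ω => expProc_nonneg ..)
    (one_div_pos.2 hδ)
  simp only [expProc_zero, integral_const, probReal_univ, smul_eq_mul, mul_one] at h
  rw [one_div, inv_mul_le_iff₀ hδ, mul_one] at h
  have hmeas : MeasurableSet {ω | ∃ t, δ⁻¹ ≤ expProc c (fun i => u i ω)
      (fun i => y i ω - p i ω) t} := by
    simp only [ofPred_exists]
    exact MeasurableSet.iUnion fun t => measurableSet_le measurable_const
      ((hM.stronglyMeasurable t).measurable.mono (ℱ.le t) le_rfl)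
  have e1 : {ω | ∀ t, expProc c (fun i => u i ω) (fun i => y i ω - p i ω) t < 1 / δ}
      = {ω | ∃ t, δ⁻¹ ≤ expProc c (fun i => u i ω) (fun i => y i ω - p i ω) t}ᶜ := by
    ext ω
    simp
  rw [e1, probReal_compl_eq_one_sub hmeas]
  linarith

end SelfNormalized

/-! ### Confidence bands for the projected estimate. -/

section Confidence

variable {X : Type*} {H : Type*} [NormedAddCommGroup H] [InnerProductSpace ℝ H]
  [CompleteSpace H] [RKHS ℝ H X ℝ]

lemma inner_feature (z : X) (h : H) : inner ℝ (feature H z) h = h z := by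
  simp [feature]

lemma ker_eq_inner (z z' : X) : ker H z z' = inner ℝ (feature H z) (feature H z') := by
  rw [inner_feature, feature, RKHS.kerFun_apply, ker]

lemma norm_feature_le {z : X} (hz : ker H z z ≤ 1) : ‖feature H z‖ ≤ 1 := by
  rw [ker_eq_inner, real_inner_self_eq_norm_sq] at hz
  exact (sq_le_one_iff₀ (norm_nonneg _)).1 hz

lemma apply_mem_Icc {z : X} (hz : ker H z z ≤ 1) {B : ℝ} {h : H} (hh : ‖h‖ ≤ B) :
    h z ∈ Icc (-B) B := by
  refine mem_Icc.2 (abs_le.1 ?_)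
  rw [← inner_feature]
  refine (abs_real_inner_le_norm _ _).trans ?_
  have := mul_le_mul (norm_feature_le hz) hh (norm_nonneg _) zero_le_one
  linarith

variable (H) in
lemma covOp_eq (lam B : ℝ) {t : ℕ} (x : Fin t → X) :
    covOp H lam B x = regOp (lam * kappa B) fun i => feature H (x i) := by
  rw [covOp, regOp, mul_comm]

lemma invCovNorm_eq (lam B : ℝ) {t : ℕ} (x : Fin t → X) (h : H) :
    invCovNorm lam B x h = √(regForm (lam * kappa B) (fun i => feature H (x i)) h h) := by
  rw [invCovNorm, covOp_eq, regForm]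

variable (H) in
lemma kernelMatrix_eq {t : ℕ} (x : Fin t → X) :
    kernelMatrix H x = gramMat fun i => feature H (x i) := by
  ext i j
  rw [kernelMatrix, gramMat, Matrix.of_apply, Matrix.of_apply, ker_eq_inner]

variable (H) in
lemma sigmaT_eq {lam B : ℝ} (hc : 0 < lam * kappa B) {t : ℕ} (x : Fin t → X) (z : X) :
    sigmaT H lam B x z = √(lam * kappa B *
      regForm (lam * kappa B) (fun i => feature H (x i)) (feature H z) (feature H z)) := by
  have : kernelVec H x z = fun i => inner ℝ (feature H (x i)) (feature H z) :=
    funext fun i => ker_eq_inner (x i) z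
  rw [regForm_self_eq hc, mul_inv_cancel_left₀ hc.ne', sigmaT, this, kernelMatrix_eq, ker_eq_inner]

lemma hasDerivAt_logisticLoss_line (lam : ℝ) {t : ℕ} (x : Fin t → X) (y : Fin t → ℝ) (f h : H) :
    HasDerivAt (fun r : ℝ => logisticLoss lam x y (f + r • h))
      (inner ℝ (gradMap lam x f - ∑ i, y i • feature H (x i)) h) 0 := by
  have h1 (i : Fin t) : HasDerivAt (fun r : ℝ =>
      -y i * Real.log (Real.sigmoid (f (x i) + r * h (x i)))
      - (1 - y i) * Real.log (1 - Real.sigmoid (f (x i) + r * h (x i))))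
      ((Real.sigmoid (f (x i)) - y i) * h (x i)) 0 := by
    have hl : HasDerivAt (fun r : ℝ => f (x i) + r * h (x i)) (h (x i)) 0 := by
      simpa using ((hasDerivAt_id (0 : ℝ)).mul_const (h (x i))).const_add (f (x i))
    have hs : HasDerivAt (fun r : ℝ => Real.sigmoid (f (x i) + r * h (x i)))
        (Real.sigmoid (f (x i)) * (1 - Real.sigmoid (f (x i))) * h (x i)) 0 := by
      refine ((Real.hasDerivAt_sigmoid (f (x i) + 0 * h (x i))).comp (0 : ℝ) hl).congr_deriv ?_
      simp only [zero_mul, add_zero]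
    have p0 := Real.sigmoid_pos (f (x i))
    have p1 := sub_pos.2 (Real.sigmoid_lt_one (f (x i)))
    have := ((hs.log (by simpa using p0.ne')).const_mul (-y i)).sub
      (((hs.const_sub 1).log (by simpa using p1.ne')).const_mul (1 - y i))
    refine this.congr_deriv ?_
    simp only [zero_mul, add_zero]
    field_simp
    ring
  have h2 : HasDerivAt (fun r : ℝ => lam / 2 * (‖f‖ ^ 2 + 2 * (r * inner ℝ f h) + r ^ 2 * ‖h‖ ^ 2))
      (lam * inner ℝ f h) 0 := by
    have := (((((hasDerivAt_id (0 : ℝ)).mul_const (inner ℝ f h)).const_mul 2).const_add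
      (‖f‖ ^ 2)).add (((hasDerivAt_id (0 : ℝ)).pow 2).mul_const (‖h‖ ^ 2))).const_mul (lam / 2)
    refine this.congr_deriv ?_
    simp only [id]
    ring
  refine (((HasDerivAt.fun_sum (u := Finset.univ) fun i _ => h1 i).add h2).congr_of_eventuallyEq
    (.of_forall fun r => ?_)).congr_deriv ?_
  · simp only [logisticLoss, Pi.add_apply, RKHS.coe_add, RKHS.coe_smul, Pi.smul_apply, smul_eq_mul,
      norm_add_sq_real, inner_smul_right, norm_smul, mul_pow, Real.norm_eq_abs, sq_abs]
  · simp only [gradMap, inner_sub_left, inner_add_left, sum_inner, inner_smul_left, inner_feature,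
      RCLike.conj_to_real, sub_mul, Finset.sum_sub_distrib]
    ring

/-- First-order stationarity, obtained from derivatives along lines through `f`. -/
lemma gradMap_of_isMinOn {lam : ℝ} {t : ℕ} {x : Fin t → X} {y : Fin t → ℝ} {f : H}
    (hf : IsMinOn (logisticLoss lam x y) univ f) :
    gradMap lam x f = ∑ i, y i • feature H (x i) := by
  refine sub_eq_zero.1 (ext_inner_right ℝ fun h => ?_)
  rw [inner_zero_left]
  refine IsLocalMin.hasDerivAt_eq_zero (Filter.Eventually.of_forall fun r => ?_)
    (hasDerivAt_logisticLoss_line lam x y f h)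
  simpa using hf (mem_univ (f + r • h))

/-- The map `g_t` is strongly monotone on the ball, in the norm of `V_t`. -/
lemma inner_regOp_le_inner_gradMap_sub {lam B : ℝ} (hk : ∀ z : X, ker H z z ≤ 1)
    {t : ℕ} (x : Fin t → X) {f h : H} (hf : ‖f‖ ≤ B) (hh : ‖h‖ ≤ B) :
    inner ℝ (h - f) (regOp (lam * kappa B) (fun i => feature H (x i)) (h - f))
      ≤ kappa B * inner ℝ (gradMap lam x h - gradMap lam x f) (h - f) := by
  have h1 : inner ℝ (gradMap lam x h - gradMap lam x f) (h - f)
      = (∑ i, (Real.sigmoid (h (x i)) - Real.sigmoid (f (x i))) * (h (x i) - f (x i)))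
        + lam * inner ℝ (h - f) (h - f) := by
    have : gradMap lam x h - gradMap lam x f
        = (∑ i, (Real.sigmoid (h (x i)) - Real.sigmoid (f (x i))) • feature H (x i))
          + lam • (h - f) := by
      simp only [gradMap, sub_smul, Finset.sum_sub_distrib, smul_sub]
      abel
    rw [this]
    simp only [inner_add_left, sum_inner, inner_smul_left, inner_feature, RCLike.conj_to_real,
      RKHS.coe_sub, Pi.sub_apply]
  rw [inner_regOp, h1, mul_add, Finset.mul_sum]
  refine add_le_add (Finset.sum_le_sum fun i _ => ?_) (by linarith)
  simp only [inner_feature, RKHS.coe_sub, Pi.sub_apply]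
  rw [← sq]
  exact sq_le_kappa_mul_sigmoid_sub (apply_mem_Icc (hk _) hh) (apply_mem_Icc (hk _) hf)

/-- The deviation of two functions in the ball is controlled by that of their images under `g_t`. -/
lemma abs_apply_sub_le {lam B : ℝ} (hlam : 0 < lam) (hk : ∀ z : X, ker H z z ≤ 1)
    {t : ℕ} (x : Fin t → X) {f h : H} (hf : ‖f‖ ≤ B) (hh : ‖h‖ ≤ B) (z : X) :
    |h z - f z| ≤ √(kappa B / lam) * invCovNorm lam B x (gradMap lam x h - gradMap lam x f)
      * sigmaT H lam B x z := by
  have hκ : 0 < kappa B := kappa_pos ((norm_nonneg f).trans hf)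
  have hc : 0 < lam * kappa B := by positivity
  set u : Fin t → H := fun i => feature H (x i)
  set D := gradMap lam x h - gradMap lam x f
  set Q := inner ℝ (h - f) (regOp (lam * kappa B) u (h - f))
  have hQ0 : 0 ≤ Q := inner_regOp_nonneg hc u _
  have hQ : Q ≤ kappa B * inner ℝ D (h - f) := inner_regOp_le_inner_gradMap_sub hk x hf hh
  have hD0 := regForm_self_nonneg hc u D
  have hw0 := regForm_self_nonneg hc u (feature H z)
  have hDQ := inner_sq_le_regForm_mul hc u D (h - f)
  have hz := inner_sq_le_regForm_mul hc u (feature H z) (h - f)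
  rw [inner_feature, RKHS.coe_sub, Pi.sub_apply] at hz
  -- Squaring monotonicity and applying Cauchy–Schwarz yields `Q² ≤ κ²‖D‖²_{V⁻¹} Q`; then cancel
  -- `Q`.
  have hQ2 : Q ≤ kappa B ^ 2 * regForm (lam * kappa B) u D D := by
    rcases hQ0.eq_or_lt with h0 | h0
    · rw [← h0]; positivity
    · refine le_of_mul_le_mul_right ?_ h0
      calc Q * Q ≤ (kappa B * inner ℝ D (h - f)) ^ 2 := by
            rw [← sq]; exact pow_le_pow_left₀ hQ0 hQ 2
        _ = kappa B ^ 2 * inner ℝ D (h - f) ^ 2 := by ring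
        _ ≤ kappa B ^ 2 * (regForm (lam * kappa B) u D D * Q) := by gcongr
        _ = _ := by ring
  -- The prefactor arises from `κ² = (κ/λ)(λκ)`, with `λκ` absorbed into `σ²`.
  rw [sigmaT_eq H hc, invCovNorm_eq, ← Real.sqrt_mul (by positivity),
    ← Real.sqrt_mul (by positivity)]
  refine Real.le_sqrt_of_sq_le ?_
  rw [sq_abs]
  calc (h z - f z) ^ 2 ≤ regForm (lam * kappa B) u (feature H z) (feature H z) * Q := hz
    _ ≤ regForm (lam * kappa B) u (feature H z) (feature H z)
        * (kappa B ^ 2 * regForm (lam * kappa B) u D D) := by gcongr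
    _ = _ := by
        change _ = kappa B / lam * regForm (lam * kappa B) u D D
          * (lam * kappa B * regForm (lam * kappa B) u (feature H z) (feature H z))
        field_simp

lemma invCovNorm_add_le {lam B : ℝ} (hc : 0 < lam * kappa B) {t : ℕ} (x : Fin t → X) (p q : H) :
    invCovNorm lam B x (p + q) ≤ invCovNorm lam B x p + invCovNorm lam B x q := by
  simp only [invCovNorm_eq]
  exact sqrt_regForm_add_le hc _ p q

lemma invCovNorm_neg (lam B : ℝ) {t : ℕ} (x : Fin t → X) (p : H) :
    invCovNorm lam B x (-p) = invCovNorm lam B x p := by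
  simp [invCovNorm]

/-- Regularization bias: since `V⁻¹ ≤ (λκ)⁻¹`, the factors `λ` and `κ` cancel exactly. -/
lemma invCovNorm_smul_le {lam B : ℝ} (hlam : 0 < lam) {t : ℕ} (x : Fin t → X) {f : H}
    (hf : ‖f‖ ≤ B) : √(kappa B / lam) * invCovNorm lam B x (lam • f) ≤ B := by
  have hB : 0 ≤ B := (norm_nonneg f).trans hf
  have hκ : 0 < kappa B := kappa_pos hB
  have hc : 0 < lam * kappa B := by positivity
  rw [invCovNorm_eq, ← Real.sqrt_mul (by positivity)]
  refine Real.sqrt_le_iff.2 ⟨hB, ?_⟩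
  calc _ ≤ kappa B / lam * (‖lam • f‖ ^ 2 / (lam * kappa B)) := by
        gcongr; exact regForm_self_le hc _ _
    _ = ‖f‖ ^ 2 := by
        rw [norm_smul, Real.norm_of_nonneg hlam.le]
        field_simp
    _ ≤ B ^ 2 := by gcongr

/-- Width of the confidence band around the estimate, given a bound on the self-normalized noise. -/
lemma abs_sigmoid_estimate_sub_le {lam B : ℝ} (hlam : 0 < lam) (hk : ∀ z : X, ker H z z ≤ 1)
    {t : ℕ} {x : Fin t → X} {y : Fin t → ℝ} {f h : H} (hf : ‖f‖ ≤ B)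
    (hh : IsEstimate lam B x y h) {G : ℝ}
    (hG : regForm (lam * kappa B) (fun i => feature H (x i))
      (∑ i, (y i - Real.sigmoid (f (x i))) • feature H (x i))
      (∑ i, (y i - Real.sigmoid (f (x i))) • feature H (x i)) ≤ 2 * G) (z : X) :
    |Real.sigmoid (h z) - Real.sigmoid (f z)|
      ≤ (4 * lipConst B * B + 2 * lipConst B * √(2 * kappa B / lam * G)) * sigmaT H lam B x z := by
  obtain ⟨f₀, hmin, hhB, hproj⟩ := hh
  have hB : 0 ≤ B := (norm_nonneg f).trans hf
  have hκ : 0 < kappa B := kappa_pos hB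
  have hL : 0 < lipConst B := lipConst_pos hB
  have hc : 0 < lam * kappa B := by positivity
  set S := ∑ i, (y i - Real.sigmoid (f (x i))) • feature H (x i) with hS
  have hσ : 0 ≤ sigmaT H lam B x z := Real.sqrt_nonneg _
  set N := invCovNorm (H := H) lam B x with hN
  have hg0 : gradMap lam x f - gradMap lam x f₀ = -S + lam • f := by
    rw [gradMap_of_isMinOn hmin, hS, gradMap]
    simp only [sub_smul, Finset.sum_sub_distrib]
    abel
  -- The 2 is the cost of projection: `f` is feasible, so the image of `h` is no farther from that
  -- of `f₀` than the image of `f` is.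
  have hD : N (gradMap lam x h - gradMap lam x f) ≤ 2 * (N S + N (lam • f)) := by
    have e1 : gradMap lam x h - gradMap lam x f = (gradMap lam x h - gradMap lam x f₀)
        + -(gradMap lam x f - gradMap lam x f₀) := by abel
    have h1 := invCovNorm_add_le hc x (gradMap lam x h - gradMap lam x f₀)
      (-(gradMap lam x f - gradMap lam x f₀))
    rw [invCovNorm_neg, ← e1] at h1
    have h2 := hproj f hf
    have h3 := invCovNorm_add_le hc x (-S) (lam • f)
    rw [invCovNorm_neg, ← hg0] at h3
    simp only [hN]
    linarith
  have hNS : √(kappa B / lam) * N S ≤ √(2 * kappa B / lam * G) := by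
    rw [hN, invCovNorm_eq, ← Real.sqrt_mul (by positivity)]
    refine Real.sqrt_le_sqrt ?_
    calc _ ≤ kappa B / lam * (2 * G) := by gcongr
      _ = _ := by ring
  have hNf : √(kappa B / lam) * N (lam • f) ≤ B := invCovNorm_smul_le hlam x hf
  calc |Real.sigmoid (h z) - Real.sigmoid (f z)| ≤ lipConst B * |h z - f z| :=
        abs_sigmoid_sub_le (apply_mem_Icc (hk z) hhB) (apply_mem_Icc (hk z) hf)
    _ ≤ lipConst B * (√(kappa B / lam) * N (gradMap lam x h - gradMap lam x f)
          * sigmaT H lam B x z) := by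
        gcongr; exact abs_apply_sub_le hlam hk x hf hhB z
    _ ≤ lipConst B * (√(kappa B / lam) * (2 * (N S + N (lam • f))) * sigmaT H lam B x z) := by
        gcongr
    _ = lipConst B * (2 * (√(kappa B / lam) * N S + √(kappa B / lam) * N (lam • f)))
          * sigmaT H lam B x z := by ring
    _ ≤ lipConst B * (2 * (√(2 * kappa B / lam * G) + B)) * sigmaT H lam B x z := by gcongr
    -- The bias contributes only `2LB`; the stated `4LB` leaves slack.
    _ ≤ _ := by
        gcongr
        nlinarith [mul_nonneg hL.le hB]

end Confidence

/-! ### Information gain and regret. -/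

section Regret

variable {X : Type*} {H : Type*} [NormedAddCommGroup H] [InnerProductSpace ℝ H]
  [CompleteSpace H] [RKHS ℝ H X ℝ]

/-- Makes the supremum defining `gammaT` one over a bounded set; otherwise the real `⨆` would
default to 0. -/
lemma det_one_add_gramMat_le {E : Type*} [NormedAddCommGroup E] [InnerProductSpace ℝ E]
    [CompleteSpace E] {c : ℝ} (hc : 0 < c) {t : ℕ} {u : Fin t → E} (hu : ∀ i, ‖u i‖ ≤ 1) :
    (1 + c⁻¹ • gramMat u).det ≤ (1 + c⁻¹) ^ t := by
  induction t with
  | zero => simp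
  | succ t ih =>
    rw [det_one_add_gramMat_succ hc, pow_succ]
    have h1 := regForm_self_le hc (fun i : Fin t => u i.castSucc) (u (Fin.last t))
    have h2 := regForm_self_nonneg hc (fun i : Fin t => u i.castSucc) (u (Fin.last t))
    have h3 : ‖u (Fin.last t)‖ ^ 2 / c ≤ c⁻¹ := by
      rw [div_eq_mul_inv]
      exact mul_le_of_le_one_left (by positivity) (pow_le_one₀ (norm_nonneg _) (hu _))
    exact mul_le_mul (ih fun i => hu _) (by linarith) (by linarith) (by positivity)

section InformationGain

variable {lam B : ℝ} (hc : 0 < lam * kappa B)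
include hc

lemma le_gammaT (hk : ∀ z : X, ker H z z ≤ 1) {t : ℕ} (x : Fin t → X) :
    1 / 2 * Real.log (1 + (lam * kappa B)⁻¹ • gramMat fun i => feature H (x i)).det
      ≤ gammaT X H lam B t := by
  rw [← kernelMatrix_eq]
  refine le_ciSup (f := fun x : Fin t → X => 1 / 2 * Real.log
    (1 + (lam * kappa B)⁻¹ • kernelMatrix H x : Matrix (Fin t) (Fin t) ℝ).det)
    ⟨1 / 2 * Real.log ((1 + (lam * kappa B)⁻¹) ^ t), ?_⟩ x
  rintro _ ⟨x, rfl⟩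
  simp only [kernelMatrix_eq]
  have h1 := one_le_det_one_add_gramMat hc fun i => feature H (x i)
  have h2 := det_one_add_gramMat_le hc (u := fun i => feature H (x i))
    fun i => norm_feature_le (hk _)
  gcongr

lemma gammaT_nonneg (hk : ∀ z : X, ker H z z ≤ 1) [Nonempty X] (t : ℕ) :
    0 ≤ gammaT X H lam B t := by
  obtain ⟨z⟩ := ‹Nonempty X›
  refine le_trans ?_ (le_gammaT hc hk fun _ : Fin t => z)
  have := Real.log_nonneg (one_le_det_one_add_gramMat hc fun _ : Fin t => feature H z)
  positivity

lemma gammaT_mono (hk : ∀ z : X, ker H z z ≤ 1) [Nonempty X] : Monotone (gammaT X H lam B) := by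
  refine monotone_nat_of_le_succ fun t => ciSup_le fun x => ?_
  obtain ⟨z⟩ := ‹Nonempty X›
  refine le_trans ?_ (le_gammaT hc hk (Fin.snoc x z : Fin (t + 1) → X))
  rw [kernelMatrix_eq, det_one_add_gramMat_succ hc]
  simp only [Fin.snoc_castSucc, Fin.snoc_last]
  have h1 := one_le_det_one_add_gramMat hc fun i => feature H (x i)
  have h2 := regForm_self_nonneg hc (fun i => feature H (x i)) (feature H z)
  gcongr
  nlinarith

/-- The elliptical potential bound for the posterior variances. -/
lemma sum_sigmaT_sq_le (hk : ∀ z : X, ker H z z ≤ 1) (x : ℕ → X) (T : ℕ) :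
    Real.log (1 + (lam * kappa B)⁻¹)
        * ∑ t ∈ Finset.range T, sigmaT H lam B (fun i : Fin t => x i) (x t) ^ 2
      ≤ 2 * gammaT X H lam B T := by
  suffices h : Real.log (1 + (lam * kappa B)⁻¹)
        * ∑ t ∈ Finset.range T, sigmaT H lam B (fun i : Fin t => x i) (x t) ^ 2
      ≤ Real.log (1 + (lam * kappa B)⁻¹ • gramMat fun i : Fin T => feature H (x i)).det by
    have := le_gammaT hc hk fun i : Fin T => x i
    linarith
  induction T with
  | zero => simp
  | succ T ih =>
    rw [Finset.sum_range_succ, mul_add, det_one_add_gramMat_succ hc]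
    simp only [Fin.val_castSucc, Fin.val_last]
    set u : Fin T → H := fun i => feature H (x i)
    have h1 := one_le_det_one_add_gramMat hc u
    have hw := regForm_self_nonneg hc u (feature H (x T))
    have hw1 := regForm_self_le hc u (feature H (x T))
    set w := regForm (lam * kappa B) u (feature H (x T)) (feature H (x T))
    rw [Real.log_mul (by linarith) (by linarith)]
    refine add_le_add ih ?_
    rw [sigmaT_eq H hc, Real.sq_sqrt (by positivity)]
    change _ * (lam * kappa B * w) ≤ Real.log (1 + w)
    have hs1 : lam * kappa B * w ≤ 1 := by
      rw [le_div_iff₀ hc] at hw1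
      have := pow_le_one₀ (n := 2) (norm_nonneg _) (norm_feature_le (hk (x T)))
      linarith
    -- Bernoulli's inequality with exponent `σ² = cw ≤ 1`: `(1 + c⁻¹)^{σ²} ≤ 1 + w`. Taking
    -- logarithms gives the constant `log(1 + c⁻¹)`.
    have hb := rpow_one_add_le_one_add_mul_self (s := (lam * kappa B)⁻¹)
      (by linarith [inv_pos.2 hc]) (by positivity : 0 ≤ lam * kappa B * w) hs1
    have hb2 := Real.log_le_log (by positivity) hb
    rw [Real.log_rpow (by positivity)] at hb2
    have e1 : lam * kappa B * w * (lam * kappa B)⁻¹ = w := by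
      rw [mul_right_comm, mul_inv_cancel₀ hc.ne', one_mul]
    rw [e1] at hb2
    linarith

end InformationGain

/-- Measurable functions form a closed subspace, since norm convergence in an RKHS is pointwise, and
it contains the kernel sections, whose span is dense. -/
lemma measurable_coe_of_measurable_ker [MeasurableSpace X]
    (hmeas : Measurable fun p : X × X => ker H p.1 p.2) (f : H) : Measurable f := by
  let S : Submodule ℝ H :=
    { carrier := {h | Measurable h}
      add_mem' := fun {a b} ha hb => by
        change Measurable (⇑(a + b)); rw [RKHS.coe_add]; exact Measurable.add ha hb
      zero_mem' := by
        change Measurable (⇑(0 : H)); rw [RKHS.coe_zero]; exact measurable_zero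
      smul_mem' := fun r a ha => by
        change Measurable (⇑(r • a)); rw [RKHS.coe_smul]; exact Measurable.const_smul ha r }
  have hcl : IsClosed (S : Set H) := by
    refine IsSeqClosed.isClosed fun h l hh hl => ?_
    refine measurable_of_tendsto_metrizable hh (tendsto_pi_nhds.2 fun z => ?_)
    exact ((RKHS.continuous_eval z).tendsto l).comp hl
  have htop : (⊤ : Submodule ℝ H) ≤ S := by
    rw [← RKHS.kerFun_dense H]
    refine Submodule.topologicalClosure_minimal _ (Submodule.span_le.2 ?_) hcl
    rintro _ ⟨z, v, rfl⟩
    have h1 : RKHS.kerFun H z v = v • feature H z := by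
      rw [feature, ← map_smul, smul_eq_mul, mul_one]
    rw [h1]
    refine S.smul_mem v ?_
    have h2 : ⇑(feature H z) = fun z' => ker H z z' := by
      ext z'
      rw [ker_eq_inner, real_inner_comm, inner_feature]
    change Measurable (⇑(feature H z))
    rw [h2]
    have h3 : Measurable fun z' : X => (z, z') := measurable_prodMk_left
    simpa only [Function.comp_def] using hmeas.comp h3
  exact htop (Submodule.mem_top (x := f))

/-- The deterministic regret bound: if all the confidence bands are valid along a run of LGP-UCB,
the logistic regret is controlled by the information gain. -/
lemma logisticRegret_le [Nonempty X] {lam B δ : ℝ} (hlam : 0 < lam)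
    (hk : ∀ z : X, ker H z z ≤ 1) {f : H} (hf : ‖f‖ ≤ B) {xstar : X} {x : ℕ → X} {h : ℕ → H}
    (hopt : ∀ t : ℕ, IsMaxOn (fun z : X => Real.sigmoid (h t z)
      + betaT X H lam B δ t * sigmaT H lam B (fun i : Fin t => x i) z) univ (x t))
    (hconf : ∀ (t : ℕ) (z : X), |Real.sigmoid (h t z) - Real.sigmoid (f z)|
      ≤ betaT X H lam B δ t * sigmaT H lam B (fun i : Fin t => x i) z) (T : ℕ) :
    logisticRegret f xstar x T ≤ regretConst lam B * betaT X H lam B δ T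
      * √(T * gammaT X H lam B T) := by
  have hB : 0 ≤ B := (norm_nonneg f).trans hf
  have hκ : 0 < kappa B := kappa_pos hB
  have hL : 0 < lipConst B := lipConst_pos hB
  have hc : 0 < lam * kappa B := by positivity
  set σ : ℕ → ℝ := fun t => sigmaT H lam B (fun i : Fin t => x i) (x t) with hσ
  have hσ0 (t : ℕ) : 0 ≤ σ t := Real.sqrt_nonneg _
  have hβ : Monotone (betaT X H lam B δ) := fun s t hst => by
    have := gammaT_mono hc hk hst
    unfold betaT
    gcongr
  have hβ0 : 0 ≤ betaT X H lam B δ T := by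
    unfold betaT
    positivity
  have hγ := gammaT_nonneg hc hk T
  set ℓ := Real.log (1 + (lam * kappa B)⁻¹) with hℓ
  have hℓ0 : 0 < ℓ := Real.log_pos (by linarith [inv_pos.2 hc])
  -- Optimism: the upper bound at `x t` dominates the one at `xstar`, so the loss is at most one
  -- full band width at `x t`. Monotonicity of `β` then fixes the index `T`.
  have hinst (t : ℕ) (ht : t ∈ Finset.range T) :
      Real.sigmoid (f xstar) - Real.sigmoid (f (x t)) ≤ 2 * betaT X H lam B δ T * σ t := by
    have h1 := (abs_le.1 (hconf t xstar)).1
    have h2 := (abs_le.1 (hconf t (x t))).2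
    have h3 : Real.sigmoid (h t xstar)
        + betaT X H lam B δ t * sigmaT H lam B (fun i : Fin t => x i) xstar
        ≤ Real.sigmoid (h t (x t)) + betaT X H lam B δ t * σ t := hopt t (mem_univ xstar)
    change _ ≤ betaT X H lam B δ t * σ t at h2
    have h4 := mul_le_mul_of_nonneg_right (hβ (Finset.mem_range.1 ht).le) (hσ0 t)
    linarith
  have hsum : ∑ t ∈ Finset.range T, σ t ≤ √(2 / ℓ * (T * gammaT X H lam B T)) := by
    refine Real.le_sqrt_of_sq_le ?_
    have h1 := sq_sum_le_card_mul_sum_sq (s := Finset.range T) (f := σ)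
    rw [Finset.card_range] at h1
    have h2 : ∑ t ∈ Finset.range T, σ t ^ 2 ≤ 2 * gammaT X H lam B T / ℓ := by
      rw [le_div_iff₀ hℓ0, mul_comm]
      exact sum_sigmaT_sq_le hc hk x T
    calc _ ≤ (T : ℝ) * ∑ t ∈ Finset.range T, σ t ^ 2 := h1
      _ ≤ T * (2 * gammaT X H lam B T / ℓ) := by gcongr
      _ = _ := by ring
  have hC : regretConst lam B = 2 * √(2 / ℓ) := by
    rw [regretConst, ← hℓ, show 8 / ℓ = 2 ^ 2 * (2 / ℓ) by ring, Real.sqrt_mul (by positivity),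
      Real.sqrt_sq (by norm_num)]
  calc logisticRegret f xstar x T ≤ ∑ t ∈ Finset.range T, 2 * betaT X H lam B δ T * σ t :=
        Finset.sum_le_sum hinst
    _ = 2 * betaT X H lam B δ T * ∑ t ∈ Finset.range T, σ t := by rw [Finset.mul_sum]
    _ ≤ 2 * betaT X H lam B δ T * √(2 / ℓ * (T * gammaT X H lam B T)) := by gcongr
    _ = _ := by
        rw [Real.sqrt_mul (by positivity), hC]
        ring

/-- A bound on the exponential process bounds the self-normalized norm by the information gain. -/
lemma regForm_noiseSum_le {lam B δ : ℝ} (hc : 0 < lam * kappa B) (hδ : 0 < δ)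
    (hk : ∀ z : X, ker H z z ≤ 1) (x : ℕ → X) (e : ℕ → ℝ) (t : ℕ)
    (h : expProc (lam * kappa B) (fun i => feature H (x i)) e t < 1 / δ) :
    regForm (lam * kappa B) (fun i : Fin t => feature H (x i))
      (noiseSum (fun i => feature H (x i)) e t) (noiseSum (fun i => feature H (x i)) e t)
      ≤ 2 * (gammaT X H lam B t + Real.log (1 / δ)) := by
  have h1 := one_le_det_one_add_gramMat hc (fun i : Fin t => feature H (x i))
  have h2 := le_gammaT hc hk (fun i : Fin t => x i)
  rw [expProc, div_lt_iff₀ (Real.sqrt_pos.2 (by linarith))] at h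
  have h3 := Real.log_lt_log (Real.exp_pos _) h
  rw [Real.log_exp, Real.log_mul (by positivity) (Real.sqrt_pos.2 (by linarith)).ne',
    Real.log_sqrt (by linarith)] at h3
  linarith

end Regret

end LogisticBandit

end

theorem mainTheorem5
    {d : ℕ} (𝒳 : Set (EuclideanSpace ℝ (Fin d))) (h𝒳 : IsCompact 𝒳)
    -- the reproducing kernel Hilbert space of a normalized kernel on `𝒳`
    {H : Type*} [NormedAddCommGroup H] [InnerProductSpace ℝ H] [CompleteSpace H] [RKHS ℝ H 𝒳 ℝ]
    (hmeas : Measurable fun p : 𝒳 × 𝒳 => LogisticBandit.ker H p.1 p.2)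
    (hnorm : ∀ x : 𝒳, LogisticBandit.ker H x x ≤ 1)
    -- the utility and its maximizer
    (B : ℝ) (f : H) (hf : ‖f‖ ≤ B) (xstar : 𝒳) (hxstar : IsMaxOn (fun z : 𝒳 => f z) univ xstar)
    (lam : ℝ) (hlam : 0 < lam) (δ : ℝ) (hδ : δ ∈ Ioc (0 : ℝ) 1)
    -- a run of the algorithm
    {Ω : Type*} {m : MeasurableSpace Ω} (P : Measure Ω) [IsProbabilityMeasure P]
    (ℱ : Filtration ℕ m) (x : ℕ → Ω → 𝒳) (y : ℕ → Ω → ℝ) (fhat : ℕ → Ω → H)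
    (henv : LogisticBandit.IsLogisticFeedback P ℱ f x y)
    (halg : LogisticBandit.IsLGPUCB lam B δ x y fhat) :
    1 - δ ≤ P.real {ω | ∀ T : ℕ,
      LogisticBandit.logisticRegret f xstar (fun t => x t ω) T
        ≤ LogisticBandit.regretConst lam B * LogisticBandit.betaT 𝒳 H lam B δ T
          * Real.sqrt (T * LogisticBandit.gammaT 𝒳 H lam B T)} := by
  have : Nonempty 𝒳 := ⟨xstar⟩
  have hκ : 0 < LogisticBandit.kappa B := LogisticBandit.kappa_pos ((norm_nonneg f).trans hf)
  have hc : 0 < lam * LogisticBandit.kappa B := by positivity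
  have hfm : Measurable f := LogisticBandit.measurable_coe_of_measurable_ker hmeas f
  have hxm (t i : ℕ) (hi : i ≤ t) : Measurable[ℱ t] (x i) :=
    (henv.measurable_action i).mono (ℱ.mono hi) le_rfl
  have hgood := LogisticBandit.le_measureReal_forall_expProc_lt (P := P) (ℱ := ℱ) (y := y)
    (u := fun i ω => LogisticBandit.feature H (x i ω)) (p := fun i ω => Real.sigmoid (f (x i ω))) hc
    (fun i ω => LogisticBandit.norm_feature_le (hnorm _))
    (fun t i hi j hj => by
      simp only [← LogisticBandit.ker_eq_inner]
      have hij : Measurable[ℱ t] fun ω => (x i ω, x j ω) := (hxm t i hi).prodMk (hxm t j hj)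
      simpa only [Function.comp_def] using hmeas.comp hij)
    (fun t => continuous_sigmoid.measurable.comp (hfm.comp (henv.measurable_action t)))
    (fun t ω => ⟨Real.sigmoid_nonneg _, Real.sigmoid_le_one _⟩)
    henv.measurable_feedback henv.binary henv.prob_one hδ.1
  -- From here on the argument is pathwise on the concentration event.
  refine hgood.trans (measureReal_mono fun ω hω => ?_)
  refine LogisticBandit.logisticRegret_le hlam hnorm hf (fun t => halg.optimistic t ω)
    fun t z => ?_
  refine LogisticBandit.abs_sigmoid_estimate_sub_le hlam hnorm hf (halg.estimate t ω) ?_ z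
  have h := LogisticBandit.regForm_noiseSum_le hc hδ.1 hnorm (fun t => x t ω) _ t (hω t)
  rwa [LogisticBandit.noiseSum, Finset.sum_range] at h
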